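/- Let $A,B,T\in\mathbb R^{n\times n}$ be symmetric positive definite, let $0<\lambda_1\le\dots\le\lambda_n$ be the eigenvalues (with multiplicity) of $Au=\lambda Bu$, and put $\rho(x)=\frac{(x,Ax)}{(x,Bx)}$ for $x\ne0$. Assume that, for constants $\gamma_1,\gamma_2>0$, $$\gamma_1(z,T^{-1}z)\le (z,Az)\le\gamma_2(z,T^{-1}z)\qquad\text{for all } z\in\mathbb R^n .$$ For $x\neq 0$ let $d=T(Ax-\rho(x)Bx)$ and let $x'=x-\vartheta_{\rm opt}d$, where $\vartheta_{\rm opt}$ minimizes $\rho(x-\vartheta d)$ over $\vartheta\in\mathbb R$ (if $\rho$ has no minimizer on this line, i.e. the optimal step length is infinite, then $x'$ is a nonzero multiple of $d$). Let $1\le i\le n-1$ and $$\gamma=\frac{\gamma_2-\gamma_1}{\gamma_1+\gamma_2},\qquad \kappa=\frac{\lambda_i(\lambda_n-\lambda_{i+1})}{\lambda_{i+1}(\lambda_n-\lambda_i)},\qquad \sigma=\frac{\kappa+\gamma(2-\kappa)}{(2-\kappa)+\gamma\kappa}.$$ (a) If $\lambda_i\le\rho(x)<\lambda_{i+1}$,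 then $x'\ne0$, $\rho(x')\le\rho(x)$, and either $\rho(x')\le\lambda_i$ or $$\frac{\rho(x')-\lambda_i}{\lambda_{i+1}-\rho(x')}\le\sigma^2\,\frac{\rho(x)-\lambda_i}{\lambda_{i+1}-\rho(x)} .$$ If $\gamma_1=1-\gamma$ and $\gamma_2=1+\gamma$, then $(\gamma_2-\gamma_1)/(\gamma_1+\gamma_2)=\gamma$. (b) The estimate is sharp for $\rho(x)\to\lambda_i$. Let $i+1\neq n$, $\lambda_i<\lambda_{i+1}$, $0<\gamma_1\le\gamma_2$, and let $S$ be the span of linearly independent eigenvectors for $\lambda_i,\lambda_{i+1},\lambda_n$. Then for every $s\in(\lambda_i,\lambda_{i+1})$ there are a nonzero $x_s\in S$ with $\rho(x_s)=s$, a symmetric positive definite $T_s$ satisfying the spectral equivalence with $\gamma_1,\gamma_2$, and an iterate $x_s'\in S$ obtained from $x_s$ and $T_s$ with a (finite) minimizing step length, such that $$\lim_{s\downarrow\lambda_i}\ \frac{\rho(x_s')-\lambda_i}{\lambda_{i+1}-\rho(x_s')}\Big/\frac{s-\lambda_i}{\lambda_{i+1}-s}=\sigma^2 .$$ (c) Equivalently,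 in terms of $\mu_j=1/\lambda_j$ and $\mu(x)=\frac{(x,Bx)}{(x,Ax)}$: let $\mu(x)x'=\mu(x)x+\vartheta_{\rm opt}T(Bx-\mu(x)Ax)$, where $\vartheta_{\rm opt}$ maximizes $\mu(\mu(x)x+\vartheta T(Bx-\mu(x)Ax))$ over $\vartheta\in\mathbb R$ (if there is no maximizer, $x'$ is a nonzero multiple of $T(Bx-\mu(x)Ax)$). If $\mu_{i+1}<\mu(x)\le\mu_i$, then $x'\neq0$, $\mu(x')\ge\mu(x)$, and either $\mu(x')\ge\mu_i$ or $$\frac{\mu_i-\mu(x')}{\mu(x')-\mu_{i+1}}\le\sigma^2\,\frac{\mu_i-\mu(x)}{\mu(x)-\mu_{i+1}},\qquad \sigma=\frac{\kappa+\gamma(2-\kappa)}{(2-\kappa)+\gamma\kappa},\quad \kappa=\frac{\mu_{i+1}-\mu_n}{\mu_i-\mu_n},$$ and for $i+1\ne n$ this is sharp for $\mu(x)\to\mu_i$ in the sense of (b): under the assumptions of (b) one can choose, for every $s\in(\mu_{i+1},\mu_i)$, a nonzero $x_s\in S$ with $\mu(x_s)=s$, an admissible $T_s$ and an iterate $x_s'\in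 S$ with a finite maximizing step length such that the quotient of $\frac{\mu_i-\mu(x_s')}{\mu(x_s')-\mu_{i+1}}$ and $\frac{\mu_i-s}{s-\mu_{i+1}}$ tends to $\sigma^2$ as $s\uparrow\mu_i$. -/

import Mathlib

open Filter Topology
open scoped Matrix

noncomputable section

namespace PSD

/-- `lam` enumerates the eigenvalues of the pencil `A u = λ B u` in increasing order, with
multiplicity: it is monotone and belongs to `n` linearly independent eigenvectors. -/
def IsEigenvalueEnumeration {n : ℕ} (A B : Matrix (Fin n) (Fin n) ℝ) (lam : Fin n → ℝ) : Prop :=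
  Monotone lam ∧ ∃ u : Fin n → (Fin n → ℝ),
    LinearIndependent ℝ u ∧ ∀ i, A *ᵥ u i = lam i • (B *ᵥ u i)

/-- Such an enumeration exists for every pair of symmetric positive definite matrices. -/
theorem exists_isEigenvalueEnumeration {n : ℕ} {A B : Matrix (Fin n) (Fin n) ℝ}
    (hA : A.PosDef) (hB : B.PosDef) : ∃ lam, IsEigenvalueEnumeration A B lam := by
  classical
  obtain ⟨C, hC⟩ : ∃ C : Matrix (Fin n) (Fin n) ℝ, B = Cᴴ * C := by
    open scoped MatrixOrder Matrix.Norms.L2Operator in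
    exact CStarAlgebra.nonneg_iff_eq_star_mul_self.mp hB.posSemidef.nonneg
  have hCu : IsUnit C.det := by
    have h := (Matrix.isUnit_iff_isUnit_det _).mp hB.isUnit
    rw [hC, Matrix.det_mul] at h
    exact isUnit_of_mul_isUnit_right h
  have hM : (C⁻¹ᴴ * A * C⁻¹).IsHermitian := Matrix.isHermitian_conjTranspose_mul_mul _ hA.1
  have hCC : Cᴴ * C⁻¹ᴴ = 1 := by
    rw [← Matrix.conjTranspose_mul, Matrix.nonsing_inv_mul _ hCu, Matrix.conjTranspose_one]
  have key : ∀ j, A *ᵥ (C⁻¹ *ᵥ (hM.eigenvectorBasis j).ofLp) =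
      hM.eigenvalues j • (B *ᵥ (C⁻¹ *ᵥ (hM.eigenvectorBasis j).ofLp)) := by
    intro j
    have h := congrArg (fun v => Cᴴ *ᵥ v) (hM.mulVec_eigenvectorBasis j)
    simp only [Matrix.mulVec_smul, Matrix.mulVec_mulVec] at h
    have e1 : Cᴴ * (C⁻¹ᴴ * A * C⁻¹) = A * C⁻¹ := by
      rw [← Matrix.mul_assoc, ← Matrix.mul_assoc, hCC, Matrix.one_mul]
    have e2 : B * C⁻¹ = Cᴴ := by
      rw [hC, Matrix.mul_assoc, Matrix.mul_nonsing_inv _ hCu, Matrix.mul_one]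
    rw [e1] at h
    rw [Matrix.mulVec_mulVec, Matrix.mulVec_mulVec, e2]
    exact h
  have hli : LinearIndependent ℝ (fun j => C⁻¹ *ᵥ (hM.eigenvectorBasis j).ofLp) := by
    have h1 : LinearIndependent ℝ (fun j => (hM.eigenvectorBasis j).ofLp) := by
      have h0 := hM.eigenvectorBasis.toBasis.linearIndependent.map'
        (WithLp.linearEquiv 2 ℝ (Fin n → ℝ)).toLinearMap (LinearEquiv.ker _)
      simpa [Function.comp_def] using h0
    have hinj : Function.Injective (C⁻¹).mulVec := by
      apply Matrix.mulVec_injective_of_isUnit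
      exact (Matrix.isUnit_nonsing_inv_iff).mpr ((Matrix.isUnit_iff_isUnit_det _).mpr hCu)
    exact h1.map' (Matrix.mulVecLin C⁻¹) (LinearMap.ker_eq_bot.mpr hinj)
  exact ⟨hM.eigenvalues ∘ Tuple.sort hM.eigenvalues, Tuple.monotone_sort _,
    fun i => C⁻¹ *ᵥ (hM.eigenvectorBasis (Tuple.sort hM.eigenvalues i)).ofLp,
    hli.comp _ (Tuple.sort hM.eigenvalues).injective, fun i => key _⟩

/-- The enumeration is unique. -/
theorem IsEigenvalueEnumeration.unique {n : ℕ} {A B : Matrix (Fin n) (Fin n) ℝ}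
    (hB : B.PosDef) {lam lam' : Fin n → ℝ} (h : IsEigenvalueEnumeration A B lam)
    (h' : IsEigenvalueEnumeration A B lam') : lam = lam' := by
  have key : ∀ l : Fin n → ℝ, IsEigenvalueEnumeration A B l →
      (B⁻¹ * A).charpoly.roots = Finset.univ.val.map l := by
    rintro l ⟨-, u, hu, hev⟩
    have hBu : IsUnit B.det := (Matrix.isUnit_iff_isUnit_det _).mp hB.isUnit
    set U : Matrix (Fin n) (Fin n) ℝ := (Matrix.of u)ᵀ with hU
    have hUu : IsUnit U := (Matrix.isUnit_transpose _).mpr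
      (Matrix.linearIndependent_rows_iff_isUnit.mp hu)
    have h1 : A * U = B * (U * Matrix.diagonal l) := by
      ext a j
      have h := congrFun (hev j) a
      rw [← Matrix.mul_assoc, Matrix.mul_diagonal]
      simpa [Matrix.mul_apply, Matrix.mulVec, dotProduct, hU, mul_comm] using h
    have h2 : B⁻¹ * A = U * Matrix.diagonal l * U⁻¹ := by
      have hUd := (Matrix.isUnit_iff_isUnit_det _).mp hUu
      rw [← Matrix.nonsing_inv_mul_cancel_left B (U * Matrix.diagonal l) hBu, ← h1,
        Matrix.mul_assoc, Matrix.mul_nonsing_inv_cancel_right _ _ hUd]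
    have h3 : (B⁻¹ * A).charpoly = ∏ i, (Polynomial.X - Polynomial.C (l i)) := by
      rw [h2]
      obtain ⟨V, hV⟩ := hUu
      rw [← hV, Matrix.charpoly_units_conj V, Matrix.charpoly_diagonal]
    rw [h3]
    have h4 := Polynomial.roots_multiset_prod_X_sub_C (Finset.univ.val.map l)
    rwa [Multiset.map_map] at h4
  have hm : Finset.univ.val.map lam = Finset.univ.val.map lam' := (key _ h).symm.trans (key _ h')
  have hp : (List.ofFn lam).Perm (List.ofFn lam') := by
    rw [← Multiset.coe_eq_coe]
    simpa [Fin.univ_val_map] using hm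
  exact List.ofFn_injective (hp.eq_of_sortedLE h.1.sortedLE_ofFn h'.1.sortedLE_ofFn)

/-- The Rayleigh quotient `ρ(x) = (x, A x) / (x, B x)`. -/
def rho {n : ℕ} (A B : Matrix (Fin n) (Fin n) ℝ) (x : Fin n → ℝ) : ℝ :=
  (x ⬝ᵥ (A *ᵥ x)) / (x ⬝ᵥ (B *ᵥ x))

/-- The inverse Rayleigh quotient `μ(x) = (x, B x) / (x, A x)`. -/
def mu {n : ℕ} (A B : Matrix (Fin n) (Fin n) ℝ) (x : Fin n → ℝ) : ℝ :=
  (x ⬝ᵥ (B *ᵥ x)) / (x ⬝ᵥ (A *ᵥ x))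

/-- Spectral equivalence of the preconditioner `T` to `A⁻¹`:
`γ₁ (z, T⁻¹ z) ≤ (z, A z) ≤ γ₂ (z, T⁻¹ z)` for all `z`, with `γ₁, γ₂ > 0`. -/
def SpectrallyEquivalent {n : ℕ} (A T : Matrix (Fin n) (Fin n) ℝ) (γ₁ γ₂ : ℝ) : Prop :=
  0 < γ₁ ∧ 0 < γ₂ ∧ ∀ z : Fin n → ℝ,
    γ₁ * (z ⬝ᵥ (T⁻¹ *ᵥ z)) ≤ z ⬝ᵥ (A *ᵥ z) ∧ z ⬝ᵥ (A *ᵥ z) ≤ γ₂ * (z ⬝ᵥ (T⁻¹ *ᵥ z))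

/-- The search direction `T (A x - ρ(x) B x)`. -/
def direction {n : ℕ} (A B T : Matrix (Fin n) (Fin n) ℝ) (x : Fin n → ℝ) : Fin n → ℝ :=
  T *ᵥ (A *ᵥ x - rho A B x • (B *ᵥ x))

/-- `x' = x - ϑ T (A x - ρ(x) B x)` where `ϑ` minimizes `ρ` along that line. -/
def IsIterate {n : ℕ} (A B T : Matrix (Fin n) (Fin n) ℝ) (x x' : Fin n → ℝ) : Prop :=
  ∃ θ : ℝ, (∀ t : ℝ, rho A B (x - θ • direction A B T x) ≤ rho A B (x - t • direction A B T x)) ∧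
    x' = x - θ • direction A B T x

/-- The case of an unbounded optimal step length: `ρ` has no minimizer along the line, and the
Rayleigh-Ritz procedure on `span {x, T (A x - ρ(x) B x)}` returns the direction itself. -/
def IsUnboundedStepIterate {n : ℕ} (A B T : Matrix (Fin n) (Fin n) ℝ) (x x' : Fin n → ℝ) : Prop :=
  (∀ θ : ℝ, ∃ t : ℝ,
    rho A B (x - t • direction A B T x) < rho A B (x - θ • direction A B T x)) ∧
  ∃ c : ℝ, c ≠ 0 ∧ x' = c • direction A B T x

/-- The search direction `T (B x - μ(x) A x)` in the `μ`-notation. -/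
def muDirection {n : ℕ} (A B T : Matrix (Fin n) (Fin n) ℝ) (x : Fin n → ℝ) : Fin n → ℝ :=
  T *ᵥ (B *ᵥ x - mu A B x • (A *ᵥ x))

/-- `μ(x) x' = μ(x) x + ϑ T (B x - μ(x) A x)` where `ϑ` maximizes `μ` along that line. -/
def IsMuIterate {n : ℕ} (A B T : Matrix (Fin n) (Fin n) ℝ) (x x' : Fin n → ℝ) : Prop :=
  ∃ θ : ℝ, (∀ t : ℝ, mu A B (mu A B x • x + t • muDirection A B T x) ≤
      mu A B (mu A B x • x + θ • muDirection A B T x)) ∧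
    mu A B x • x' = mu A B x • x + θ • muDirection A B T x

/-- The case of an unbounded optimal step length in the `μ`-notation. -/
def IsMuUnboundedStepIterate {n : ℕ} (A B T : Matrix (Fin n) (Fin n) ℝ) (x x' : Fin n → ℝ) :
    Prop :=
  (∀ θ : ℝ, ∃ t : ℝ, mu A B (mu A B x • x + θ • muDirection A B T x) <
      mu A B (mu A B x • x + t • muDirection A B T x)) ∧
  ∃ c : ℝ, c ≠ 0 ∧ x' = c • muDirection A B T x

/-- `γ = (γ₂ - γ₁) / (γ₁ + γ₂)`. -/
def gam (γ₁ γ₂ : ℝ) : ℝ := (γ₂ - γ₁) / (γ₁ + γ₂)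

/-- `σ = (κ + γ (2 - κ)) / ((2 - κ) + γ κ)`. -/
def sigma (κ γ : ℝ) : ℝ := (κ + γ * (2 - κ)) / ((2 - κ) + γ * κ)

/-- `κ` in terms of `λ_i = a`, `λ_{i+1} = b`, `λ_n = c`. -/
def kappa (a b c : ℝ) : ℝ := (a * (c - b)) / (b * (c - a))

/-- `κ` in terms of `μ_i = a`, `μ_{i+1} = b`, `μ_n = c`. -/
def kappaMu (a b c : ℝ) : ℝ := (b - c) / (a - c)

end PSD

end

/-! The estimate is proved for `μ` and carried over to `ρ = 1 / μ`. In coordinates with A = I and B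
= diag(M), put m = μ(x). The residual is (M_j - m) X_j, and spectral equivalence says that the
preconditioned residual D, after scaling by 2 / (γ₁ + γ₂), deviates from it by a relative error of
at most γ. The point x + θ D has `μ`-value at least m + t exactly when ∑ (M_j - m - t) (X_j + θ
D_j)² ≥ 0. Only two facts about X and D are needed, both quadratic: ∑ (M_j - m) X_j² = 0 and the
error bound. They are absorbed by Lagrange multipliers ξ and ν ≥ 0, after which the claim splits
into one quadratic form in two variables per coordinate (`coordinate_nonneg`).

The determinant of such a form is, up to a positive factor, (1 - γ²) times the cubic with roots p -
m, q - m, r - m (p, q, r standing for μ_i, μ_{i+1}, μ_n), evaluated at M_j - m, plus a nonnegative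
square term. The cubic is nonnegative on the spectrum because no eigenvalue lies in (q, p) or below
r; larger eigenvalues than p do no harm. Matching the constant term forces t = (1 - γ²) θ² (p - m)(m
- q)(m - r), and θ is tuned so that this t yields the factor σ² exactly. One free parameter W of the
multipliers remains; `exists_multiplier` finds it.

Since θ is explicit, the optimal step can only do better. If no optimal step exists, the supremum
along the line is the value at the direction itself, so `x'` again dominates the line.

For sharpness, T acts on eigenvectors for p, q, r with factors τ, γ₁, γ₂. As μ(x) → p, the relative
gain (μ(x') - μ(x)) / (p - μ(x)) tends to the Kantorovich ratio 4 k k' / (k + k')² with k = γ₁ (p -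
q), k' = γ₂ (p - r), and 1 minus this ratio is σ². -/

/-! ### Scalar inequalities and the multiplier certificate. -/

/-- Polynomial inequality behind the choice of the step length. -/
theorem step_polynomial_nonneg {z h γ : ℝ} (hz : 0 ≤ z) (hh : 0 ≤ h) (hγ0 : 0 ≤ γ) (hγ1 : γ ≤ 1) :
    4 * (1 - γ ^ 2) * (1 + h) ^ 2 *
        ((1 - γ ^ 2) * (1 + z * (1 + h - γ)) ^ 2 + h * (2 + h)) ≤
      (2 * (1 - γ ^ 2) * (1 + z * (1 + h - γ)) + 2 * h * (2 + h) +
        2 * (1 - γ ^ 2) * γ * z * h * (1 + z * (1 + h - γ)) +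
        (1 - γ ^ 2) * (1 - γ) * h * (2 + h) * z ^ 2) ^ 2 := by
  -- Expressed through d = 1 - γ and e = 1 + γ, right side minus left side is a sum of visibly
  -- nonnegative terms.
  obtain ⟨d, hd⟩ : ∃ d, d = 1 - γ := ⟨_, rfl⟩
  have hd0 : 0 ≤ d := by linarith
  obtain ⟨e, he⟩ : ∃ e, e = 1 + γ := ⟨_, rfl⟩
  have he0 : 0 ≤ e := by linarith
  have hS : 0 ≤ 8 * γ ^ 2 * (d * e) * h + 4 * γ ^ 2 * (4 + d * e) * h ^ 2 + 16 * γ ^ 2 * h ^ 3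
      + 4 * γ ^ 2 * h ^ 4 + 8 * γ * d ^ 2 * e * (1 + 3 * γ) * (z * h)
      + 8 * γ * d * (2 + 5 * γ + γ ^ 2 * (1 + d)) * (z * h ^ 2)
      + 8 * γ * e * (d * e) * (z * h ^ 3)
      + 24 * γ * d * (d * e) ^ 2 * (z ^ 2 * h) + 36 * γ * (d * e) ^ 2 * (z ^ 2 * h ^ 2)
      + 8 * γ * (d * e) * (2 + γ * d) * (z ^ 2 * h ^ 3) + 4 * γ * e * (d * e) * (z ^ 2 * h ^ 4)
      + 8 * d * (d * e) ^ 3 * (z ^ 3 * h) + (12 + 8 * γ) * (d * e) ^ 3 * (z ^ 3 * h ^ 2)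
      + 4 * e ^ 2 * (d * e) ^ 2 * (z ^ 3 * h ^ 3) + 4 * (d * e) ^ 4 * (z ^ 4 * h ^ 2)
      + 4 * e * (d * e) ^ 3 * (z ^ 4 * h ^ 3) + e ^ 2 * (d * e) ^ 2 * (z ^ 4 * h ^ 4) := by
    positivity
  rw [← sub_nonneg]
  convert hS using 1
  subst hd he
  ring

/-- The scalar existence statement behind the estimate: a multiplier `W` for the cubic. -/
theorem exists_multiplier {α B C γ : ℝ} (hα : 0 ≤ α) (hB : 0 < B) (hBC : B ≤ C)
    (hγ0 : 0 < γ) (hγ1 : γ < 1)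
    (h : 4 * (α + C) * (1 + (1 - γ ^ 2) * α * C) =
      C * (2 * α + (1 - γ) * B + (1 + γ) * C) ^ 2) :
    ∃ W, C ≤ W ∧ (1 - W) ^ 2 * (W + (1 - γ ^ 2) * α * B * C) ≤
      (1 - γ ^ 2) * (W + α) * (W - B) * (W - C) := by
  have hC : 0 < C := hB.trans_le hBC
  have hg : 0 < 1 - γ ^ 2 := by nlinarith
  -- For C ≤ 1 the choice W = 1 annihilates the left side and leaves a product of nonnegative
  -- factors on the right.
  rcases le_or_gt C 1 with hC1 | hC1
  · refine ⟨1, hC1, ?_⟩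
    have : 0 ≤ (1 - γ ^ 2) * (1 + α) * (1 - B) * (1 - C) := by
      have h1 : 0 ≤ 1 - B := by linarith
      have h2 : 0 ≤ 1 - C := by linarith
      positivity
    linarith
  obtain ⟨Q, hQ0, hQ⟩ : ∃ Q : ℝ, 1 ≤ Q ∧ Q ^ 2 = 1 + (1 - γ ^ 2) * α * C := by
    have h1 : 1 ≤ 1 + (1 - γ ^ 2) * α * C := by
      have : 0 ≤ (1 - γ ^ 2) * α * C := by positivity
      linarith
    exact ⟨√(1 + (1 - γ ^ 2) * α * C), Real.one_le_sqrt.mpr h1, Real.sq_sqrt (by linarith)⟩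
  have hQγ : 0 < Q - γ := by linarith
  obtain ⟨z, hz⟩ : ∃ z, z = (C - 1) / (Q - γ) := ⟨_, rfl⟩
  have hz0 : 0 < z := by rw [hz]; exact div_pos (by linarith) hQγ
  have hCz : C = 1 + z * (Q - γ) := by
    rw [hz, div_mul_cancel₀ _ hQγ.ne']; ring
  -- With b in place of B, right side minus left side becomes -W (γ (W - 1) - (1 - γ²)(1 + α) z)²,
  -- which has a double root in W. The proof compares B with b and takes W at that root.
  obtain ⟨b, hb⟩ : ∃ b, b = (1 - 2 * γ * z - (1 - γ ^ 2) * z ^ 2) / C := ⟨_, rfl⟩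
  have hbC : b * C = 1 - 2 * γ * z - (1 - γ ^ 2) * z ^ 2 := by
    rw [hb, div_mul_cancel₀ _ hC.ne']
  have hsum : b + C = 2 - 2 * γ * z + α * (1 - γ ^ 2) * z ^ 2 := by
    apply mul_right_cancel₀ hC.ne'
    have : (C - 1 + γ * z) ^ 2 = z ^ 2 * Q ^ 2 := by rw [hCz]; ring
    rw [hQ] at this
    linear_combination hbC + this
  have hBb : B ≤ b := by
    -- At b the constraint `h` holds as an inequality, while it is an equality at B; monotonicity in
    -- B then gives B ≤ b. The polynomial inequality is used with its `h` equal to Q - 1.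
    have hlow : 4 * Q ^ 2 * (α + C) ≤ C * (2 * α + (1 - γ) * b + (1 + γ) * C) ^ 2 := by
      have hp := step_polynomial_nonneg hz0.le (sub_nonneg.mpr hQ0) hγ0.le hγ1.le
      have e1 : 1 + z * (1 + (Q - 1) - γ) = C := by rw [hCz]; ring
      have e2 : (Q - 1) * (2 + (Q - 1)) = (1 - γ ^ 2) * α * C := by linear_combination hQ
      have e3 : 2 * α + (1 - γ) * b + (1 + γ) * C =
          2 * α + 2 + 2 * γ * z * (Q - 1) + (1 - γ) * α * (1 - γ ^ 2) * z ^ 2 := by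
        linear_combination (1 - γ) * hsum + 2 * γ * hCz
      rw [e1, e2] at hp
      have e4 : (2 * (1 - γ ^ 2) * C + 2 * (Q - 1) * (2 + (Q - 1)) +
          2 * (1 - γ ^ 2) * γ * z * (Q - 1) * C +
          (1 - γ ^ 2) * (1 - γ) * (Q - 1) * (2 + (Q - 1)) * z ^ 2) =
          (1 - γ ^ 2) * C * (2 * α + (1 - γ) * b + (1 + γ) * C) := by
        rw [e3]
        linear_combination (2 + (1 - γ ^ 2) * (1 - γ) * z ^ 2) * e2
      rw [e4] at hp
      have hpos : 0 < (1 - γ ^ 2) ^ 2 * C := by positivity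
      refine le_of_mul_le_mul_left ?_ hpos
      linarith
    rw [← hQ] at h
    have h2 : (2 * α + (1 - γ) * B + (1 + γ) * C) ^ 2 ≤
        (2 * α + (1 - γ) * b + (1 + γ) * C) ^ 2 := by
      refine le_of_mul_le_mul_left ?_ hC
      rw [← h]
      linarith
    have h3 : 0 ≤ 2 * α + (1 - γ) * b + (1 + γ) * C := by
      have e3 : 2 * α + (1 - γ) * b + (1 + γ) * C =
          2 * α + 2 + 2 * γ * z * (Q - 1) + (1 - γ) * α * (1 - γ ^ 2) * z ^ 2 := by
        linear_combination (1 - γ) * hsum + 2 * γ * hCz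
      rw [e3]
      have : 0 ≤ Q - 1 := by linarith
      have : 0 ≤ 1 - γ := by linarith
      positivity
    have h4 := abs_le_of_sq_le_sq' h2 h3 |>.2
    have h5 : (1 - γ) * B ≤ (1 - γ) * b := by linarith
    exact le_of_mul_le_mul_left h5 (by linarith)
  obtain ⟨W, hW⟩ : ∃ W, W = 1 + (1 - γ ^ 2) * (1 + α) * z / γ := ⟨_, rfl⟩
  have hWγ : γ * (W - 1) = (1 - γ ^ 2) * (1 + α) * z := by
    rw [hW]; field_simp; ring
  have hWC : C ≤ W := by
    have hb0 : 0 < b * C := mul_pos (hB.trans_le hBb) hC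
    rw [hbC] at hb0
    -- b C factors as (1 - (1 + γ) z)(1 + (1 - γ) z), so b > 0 bounds z from above.
    have hz1 : (1 + γ) * z < 1 := by
      by_contra! hcon
      have : (1 - (1 + γ) * z) * (1 + (1 - γ) * z) ≤ 0 :=
        mul_nonpos_of_nonpos_of_nonneg (by linarith)
          (by have : 0 ≤ 1 - γ := by linarith
              positivity)
      nlinarith
    have hC2 : (1 + γ) * C ≤ 1 + Q := by
      have : (1 + γ) * z * (Q - γ) ≤ 1 * (Q - γ) :=
        mul_le_mul_of_nonneg_right hz1.le hQγ.le
      rw [hCz]; linarith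
    have hQ1 : Q - 1 ≤ (1 - γ) * α := by
      have h1 : (Q - 1) * (Q + 1) ≤ (1 - γ) * α * (Q + 1) := by
        have h2 : (Q - 1) * (Q + 1) = (1 - γ) * α * ((1 + γ) * C) := by
          linear_combination hQ
        rw [h2]
        have : 0 ≤ (1 - γ) * α := mul_nonneg (by linarith) hα
        apply mul_le_mul_of_nonneg_left _ this
        linarith
      exact le_of_mul_le_mul_right h1 (by linarith)
    have h3 : γ * Q - γ ^ 2 ≤ (1 - γ ^ 2) * (1 + α) := by
      have : 0 ≤ (1 - γ) * α := mul_nonneg (by linarith) hα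
      nlinarith
    have h4 : γ * (C - 1) ≤ γ * (W - 1) := by
      rw [hWγ, hCz]
      have := mul_le_mul_of_nonneg_right h3 hz0.le
      linarith
    have := le_of_mul_le_mul_left h4 hγ0
    linarith
  refine ⟨W, hWC, ?_⟩
  have htight : (1 - γ ^ 2) * (W + α) * (W - b) * (W - C) -
      (1 - W) ^ 2 * (W + (1 - γ ^ 2) * α * b * C) = 0 := by
    have e : (1 - γ ^ 2) * (W + α) * (W - b) * (W - C) -
      (1 - W) ^ 2 * (W + (1 - γ ^ 2) * α * b * C) =
      (1 - γ ^ 2) * (W + α) * (W ^ 2 - (b + C) * W + b * C) -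
      (1 - W) ^ 2 * (W + (1 - γ ^ 2) * α * (b * C)) := by ring
    rw [e, hsum, hbC]
    linear_combination (-W * (γ * (W - 1) - (1 - γ ^ 2) * (1 + α) * z)) * hWγ
  -- Replacing b by B ≤ b changes the difference of the two sides by this nonnegative amount.
  have hmono : 0 ≤ ((1 - γ ^ 2) * (W + α) * (W - C) + (1 - W) ^ 2 * ((1 - γ ^ 2) * α * C)) *
      (b - B) := by
    have h1 : 0 ≤ W - C := by linarith
    have h2 : 0 ≤ b - B := by linarith
    have h3 : 0 ≤ W + α := by linarith
    positivity
  nlinarith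

/-- Coordinatewise form of the estimate. -/
theorem coordinate_nonneg {α B C γ W : ℝ} (hα : 0 ≤ α) (hB : 0 < B) (hBC : B ≤ C)
    (hγ1 : γ ^ 2 < 1) (hCW : C ≤ W)
    (hW : (1 - W) ^ 2 * (W + (1 - γ ^ 2) * α * B * C) ≤
      (1 - γ ^ 2) * (W + α) * (W - B) * (W - C)) :
    ∃ ν ξ : ℝ, 0 ≤ ν ∧ ∀ Y X E : ℝ, (α ≤ Y ∨ (-C ≤ Y ∧ Y ≤ -B)) →
      0 ≤ (Y - (1 - γ ^ 2) * α * B * C) * ((1 + Y) * X + E) ^ 2 +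
        ν * (E ^ 2 - γ ^ 2 * (Y * X) ^ 2) + ξ * (Y * X ^ 2) := by
  have hC : 0 < C := hB.trans_le hBC
  have hW0 : 0 < W := hC.trans_le hCW
  have hg : 0 < 1 - γ ^ 2 := by linarith
  obtain ⟨τ, hτ⟩ : ∃ τ, τ = (1 - γ ^ 2) * α * B * C := ⟨_, rfl⟩
  have hτ0 : 0 ≤ τ := by rw [hτ]; positivity
  rw [← hτ] at hW ⊢
  -- Coefficient matching in the determinant identity `hP`: τ fits the constant term of the cubic, η
  -- the linear term, and δ is what is left over in Y². The hypothesis `hW` says precisely that W² δ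
  -- ≥ 0.
  obtain ⟨η, hη⟩ : ∃ η, η = ((1 - γ ^ 2) * (B * C - α * B - α * C) - 1 + 2 * τ) / W := ⟨_, rfl⟩
  have hηW : η * W = (1 - γ ^ 2) * (B * C - α * B - α * C) - 1 + 2 * τ := by
    rw [hη, div_mul_cancel₀ _ hW0.ne']
  obtain ⟨δ, hδ⟩ : ∃ δ, δ = 2 - τ - γ ^ 2 * W + η - (1 - γ ^ 2) * (B + C - α) := ⟨_, rfl⟩
  have hδ0 : 0 ≤ δ := by
    have h1 : 0 ≤ W ^ 2 * δ := by
      have : W ^ 2 * δ = (1 - γ ^ 2) * (W + α) * (W - B) * (W - C) - (1 - W) ^ 2 * (W + τ) := by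
        rw [hδ]
        linear_combination W * hηW + hτ
      rw [this]; linarith
    exact nonneg_of_mul_nonneg_right h1 (by positivity)
  -- With ν = W + τ the coefficient of E² becomes Y + W, nonnegative since Y ≥ -C ≥ -W.
  refine ⟨W + τ, (W + τ) * η, by positivity, fun Y X E hY => ?_⟩
  have hcubic : 0 ≤ (Y - α) * (Y + B) * (Y + C) := by
    rcases hY with hY | ⟨hY1, hY2⟩
    · have h1 : 0 ≤ Y - α := by linarith
      have h2 : 0 ≤ Y + B := by linarith
      have h3 : 0 ≤ Y + C := by linarith
      positivity
    · have h1 : Y - α ≤ 0 := by linarith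
      have h2 : Y + B ≤ 0 := by linarith
      have h3 : 0 ≤ Y + C := by linarith
      exact mul_nonneg (mul_nonneg_of_nonpos_of_nonpos h1 h2) h3
  have hP : (1 + Y) ^ 2 * (Y - τ) - (Y + W) * (γ ^ 2 * Y ^ 2 - η * Y) =
      (1 - γ ^ 2) * ((Y - α) * (Y + B) * (Y + C)) + δ * Y ^ 2 := by
    rw [hδ]
    linear_combination Y * hηW - hτ
  -- Completing the square in E.
  have hkey : (Y + W) * ((Y - τ) * ((1 + Y) * X + E) ^ 2 +
        (W + τ) * (E ^ 2 - γ ^ 2 * (Y * X) ^ 2) + (W + τ) * η * (Y * X ^ 2)) =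
      ((Y + W) * E + (Y - τ) * (1 + Y) * X) ^ 2 + (W + τ) * X ^ 2 *
        ((1 - γ ^ 2) * ((Y - α) * (Y + B) * (Y + C)) + δ * Y ^ 2) := by
    rw [← hP]; ring
  have hYW : 0 ≤ Y + W := by rcases hY with hY | ⟨hY, -⟩ <;> linarith
  rcases hYW.lt_or_eq with hpos | hzero
  · refine nonneg_of_mul_nonneg_right (a := Y + W) ?_ hpos
    rw [hkey]
    have : 0 ≤ (1 - γ ^ 2) * ((Y - α) * (Y + B) * (Y + C)) := mul_nonneg hg.le hcubic
    positivity
  -- Degenerate case Y = -W: it forces W = C, then `hW` forces W = 1, and only a multiple of X²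
  -- survives.
  · have hYe : Y = -W := by linarith
    have hWC : W = C := by
      rcases hY with hY | hY
      · linarith
      · linarith [hY.1]
    have hW1 : W = 1 := by
      rw [← hWC, sub_self, mul_zero] at hW
      have : (1 - W) ^ 2 = 0 := by
        have h0 : 0 ≤ (1 - W) ^ 2 := sq_nonneg _
        by_contra hne
        have : 0 < (1 - W) ^ 2 := lt_of_le_of_ne h0 (Ne.symm hne)
        have := mul_pos this (show 0 < W + τ by linarith)
        linarith
      have := pow_eq_zero_iff (two_ne_zero) |>.mp this
      linarith
    have hη1 : η = (1 - γ ^ 2) * (B - α * B - α) - 1 + 2 * τ := by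
      rw [← hWC, hW1] at hηW; linarith
    have : (Y - τ) * ((1 + Y) * X + E) ^ 2 + (W + τ) * (E ^ 2 - γ ^ 2 * (Y * X) ^ 2) +
        (W + τ) * η * (Y * X ^ 2) = (W + τ) * X ^ 2 * (-γ ^ 2 - η) := by
      rw [hYe, hW1]; ring
    rw [this]
    have : 0 ≤ -γ ^ 2 - η := by
      have e : -γ ^ 2 - η = (1 - γ ^ 2) * (1 + α) * (1 - B) := by
        rw [hη1, hτ, ← hWC, hW1]; ring
      rw [e]
      have : 0 ≤ 1 - B := by linarith
      positivity
    positivity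

/-- The estimate for one step in coordinates that diagonalize the pencil: `M` are the eigenvalues,
`X` the coordinates of the iterate and `D` those of the search direction, which deviates from the
residual by the relative error `γ`. -/
theorem exists_good_step {ι : Type*} [Fintype ι] {M X D : ι → ℝ} {m p q r γ : ℝ}
    (hrq : r ≤ q) (hqm : q < m) (hmp : m < p) (hγ0 : 0 < γ) (hγ1 : γ < 1)
    (hM : ∀ j, p ≤ M j ∨ (r ≤ M j ∧ M j ≤ q)) (hX : ∑ j, (M j - m) * X j ^ 2 = 0)
    (hD : ∑ j, (D j - (M j - m) * X j) ^ 2 ≤ γ ^ 2 * ∑ j, ((M j - m) * X j) ^ 2) :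
    ∃ θ t : ℝ, 0 ≤ t ∧
      (p - m - t) * (m - q) = PSD.sigma (PSD.kappaMu p q r) γ ^ 2 * ((p - m) * (m - q + t)) ∧
      0 ≤ ∑ j, (M j - m - t) * (X j + θ * D j) ^ 2 := by
  obtain ⟨a, ha⟩ : ∃ a, a = p - m := ⟨_, rfl⟩
  obtain ⟨b, hb⟩ : ∃ b, b = m - q := ⟨_, rfl⟩
  obtain ⟨c, hc⟩ : ∃ c, c = m - r := ⟨_, rfl⟩
  have ha0 : 0 < a := by linarith
  have hb0 : 0 < b := by linarith
  have hbc : b ≤ c := by linarith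
  have hc0 : 0 < c := by linarith
  have hg : 0 < 1 - γ ^ 2 := by nlinarith
  have h1γ : 0 < 1 - γ := by linarith
  obtain ⟨N, hN⟩ : ∃ N, N = (1 - γ) * (a + b) + (1 + γ) * (a + c) := ⟨_, rfl⟩
  have hN0 : 0 < N := by rw [hN]; positivity
  have hden : 0 < N ^ 2 - 4 * a * (1 - γ ^ 2) * (a + c) := by
    have h1 : N ^ 2 - 4 * a * (1 - γ ^ 2) * (a + c) =
        ((1 - γ) * (a + b) - (1 + γ) * (a + c)) ^ 2 + 4 * b * (1 - γ ^ 2) * (a + c) := by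
      rw [hN]; ring
    rw [h1]
    positivity
  -- σ is a ratio of difference to sum of (1 + γ)(p - r) and (1 - γ)(p - q).
  have hσ : PSD.sigma (PSD.kappaMu p q r) γ =
      ((1 + γ) * (a + c) - (1 - γ) * (a + b)) / N := by
    have e1 : p - r = a + c := by linarith
    have e2 : q - r = c - b := by linarith
    have hac : a + c ≠ 0 := by positivity
    unfold PSD.sigma PSD.kappaMu
    rw [e1, e2]
    have h2 : (2 - (c - b) / (a + c)) + γ * ((c - b) / (a + c)) = N / (a + c) := by
      rw [hN]; field_simp; ring
    rw [h2]
    field_simp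
    ring
  -- This value makes t = (1 - γ²) θ² a b c satisfy the σ² relation; it is also the constraint
  -- required by `exists_multiplier`.
  obtain ⟨θ, hθ0, hθ⟩ : ∃ θ : ℝ, 0 < θ ∧
      θ ^ 2 * (c * (N ^ 2 - 4 * a * (1 - γ ^ 2) * (a + c))) = 4 * (a + c) := by
    have h1 : 0 < c * (N ^ 2 - 4 * a * (1 - γ ^ 2) * (a + c)) := mul_pos hc0 hden
    have h2 : 0 < 4 * (a + c) / (c * (N ^ 2 - 4 * a * (1 - γ ^ 2) * (a + c))) := by positivity
    refine ⟨√(4 * (a + c) / (c * (N ^ 2 - 4 * a * (1 - γ ^ 2) * (a + c)))),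
      Real.sqrt_pos.mpr h2, ?_⟩
    rw [Real.sq_sqrt h2.le, div_mul_cancel₀ _ h1.ne']
  obtain ⟨W, hCW, hW⟩ := exists_multiplier (α := θ * a) (B := θ * b) (C := θ * c) (γ := γ)
    (by positivity) (by positivity) (mul_le_mul_of_nonneg_left hbc hθ0.le) hγ0 hγ1
    (by rw [hN] at hθ; linear_combination (-θ) * hθ)
  obtain ⟨ν, ξ, hν, hcoord⟩ := coordinate_nonneg (α := θ * a) (B := θ * b) (C := θ * c) (γ := γ)
    (by positivity) (by positivity) (mul_le_mul_of_nonneg_left hbc hθ0.le) (by linarith) hCW hW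
  refine ⟨θ, (1 - γ ^ 2) * θ ^ 2 * (a * b * c), by positivity, ?_, ?_⟩
  · rw [hσ, div_pow, ← ha, ← hb, div_mul_eq_mul_div, eq_div_iff (by positivity)]
    rw [hN] at hθ ⊢
    linear_combination (-(1 - γ ^ 2) * a * b * (a + b)) * hθ
  -- The certificate at Y = θ (M_j - m), E = θ (D_j - (M_j - m) X_j). In the sum over j the ξ-term
  -- vanishes by `hX` and the ν-term is nonpositive by `hD`, so the first term must be nonnegative.
  · have hsum : ∀ j, 0 ≤ θ * ((M j - m - (1 - γ ^ 2) * θ ^ 2 * (a * b * c)) *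
        (X j + θ * D j) ^ 2) + ν * θ ^ 2 * ((D j - (M j - m) * X j) ^ 2 -
          γ ^ 2 * ((M j - m) * X j) ^ 2) + ξ * θ * ((M j - m) * X j ^ 2) := by
      intro j
      have h := hcoord (θ * (M j - m)) (X j) (θ * (D j - (M j - m) * X j)) (by
        rcases hM j with h | ⟨h1, h2⟩
        · left; exact mul_le_mul_of_nonneg_left (by linarith) hθ0.le
        · right
          constructor
          · have := mul_le_mul_of_nonneg_left (show -c ≤ M j - m by linarith) hθ0.le
            linarith
          · have := mul_le_mul_of_nonneg_left (show M j - m ≤ -b by linarith) hθ0.le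
            linarith)
      refine h.trans_eq ?_
      ring
    have h := Finset.sum_nonneg (s := Finset.univ) fun j _ => hsum j
    rw [Finset.sum_add_distrib, Finset.sum_add_distrib, ← Finset.mul_sum, ← Finset.mul_sum,
      ← Finset.mul_sum, hX, Finset.sum_sub_distrib, ← Finset.mul_sum] at h
    have h2 : ν * θ ^ 2 * (∑ j, (D j - (M j - m) * X j) ^ 2 -
        γ ^ 2 * ∑ j, ((M j - m) * X j) ^ 2) ≤ 0 :=
      mul_nonpos_of_nonneg_of_nonpos (by positivity) (by linarith)
    exact nonneg_of_mul_nonneg_right (a := θ) (by linarith) hθ0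

/-! ### Simultaneous diagonalization and the preconditioner in coordinates. -/

/-- Two symmetric matrices, one of them positive definite, are diagonalized by one congruence. -/
theorem exists_congruence_diagonal {n : ℕ} {A B : Matrix (Fin n) (Fin n) ℝ} (hA : A.PosDef)
    (hB : B.IsHermitian) : ∃ (U : Matrix (Fin n) (Fin n) ℝ) (M : Fin n → ℝ),
      IsUnit U.det ∧ Uᵀ * A * U = 1 ∧ Uᵀ * B * U = Matrix.diagonal M := by
  obtain ⟨C, hC⟩ : ∃ C : Matrix (Fin n) (Fin n) ℝ, A = Cᴴ * C := by
    open scoped MatrixOrder Matrix.Norms.L2Operator in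
    exact CStarAlgebra.nonneg_iff_eq_star_mul_self.mp hA.posSemidef.nonneg
  have hCu : IsUnit C.det := by
    have h := (Matrix.isUnit_iff_isUnit_det _).mp hA.isUnit
    rw [hC, Matrix.det_mul] at h
    exact isUnit_of_mul_isUnit_right h
  have hM : (C⁻¹ᴴ * B * C⁻¹).IsHermitian := Matrix.isHermitian_conjTranspose_mul_mul _ hB
  set V : Matrix (Fin n) (Fin n) ℝ := (hM.eigenvectorUnitary).1 with hV
  have hVV : star V * V = 1 := Unitary.coe_star_mul_self _
  have hCC : C⁻¹ᴴ * Cᴴ = 1 := by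
    rw [← Matrix.conjTranspose_mul, Matrix.mul_nonsing_inv _ hCu, Matrix.conjTranspose_one]
  have hdet : IsUnit (C⁻¹ * V).det := by
    rw [Matrix.det_mul]
    refine IsUnit.mul ?_ ?_
    · exact (Matrix.isUnit_nonsing_inv_det _ hCu)
    · have h := congrArg Matrix.det hVV
      rw [Matrix.det_mul, Matrix.det_one] at h
      exact IsUnit.of_mul_eq_one_right _ h
  refine ⟨C⁻¹ * V, hM.eigenvalues, hdet, ?_, ?_⟩
  · calc (C⁻¹ * V)ᵀ * A * (C⁻¹ * V) = star V * ((C⁻¹ᴴ * Cᴴ) * (C * C⁻¹)) * V := by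
          rw [hC, Matrix.transpose_mul, Matrix.star_eq_conjTranspose,
            Matrix.conjTranspose_eq_transpose_of_trivial,
            Matrix.conjTranspose_eq_transpose_of_trivial,
            Matrix.conjTranspose_eq_transpose_of_trivial]
          simp only [Matrix.mul_assoc]
      _ = 1 := by rw [hCC, Matrix.mul_nonsing_inv _ hCu, Matrix.mul_one, Matrix.mul_one, hVV]
  · have h := hM.conjStarAlgAut_star_eigenvectorUnitary
    rw [Unitary.conjStarAlgAut_star_apply] at h
    calc (C⁻¹ * V)ᵀ * B * (C⁻¹ * V) = star V * (C⁻¹ᴴ * B * C⁻¹) * V := by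
          rw [Matrix.transpose_mul, Matrix.star_eq_conjTranspose,
            Matrix.conjTranspose_eq_transpose_of_trivial,
            Matrix.conjTranspose_eq_transpose_of_trivial]
          simp only [Matrix.mul_assoc]
      _ = Matrix.diagonal hM.eigenvalues := by
          rw [hV, h]; rfl

theorem dotProduct_mulVec_congr {n : ℕ} (U A : Matrix (Fin n) (Fin n) ℝ) (ξ η : Fin n → ℝ) :
    (U *ᵥ ξ) ⬝ᵥ (A *ᵥ (U *ᵥ η)) = ξ ⬝ᵥ ((Uᵀ * A * U) *ᵥ η) := by
  rw [Matrix.mul_assoc, ← Matrix.mulVec_mulVec, ← Matrix.mulVec_mulVec,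
    Matrix.dotProduct_mulVec ξ, Matrix.vecMul_transpose]

theorem dotProduct_mulVec_one_of_congr {n : ℕ} {U A : Matrix (Fin n) (Fin n) ℝ}
    (h : Uᵀ * A * U = 1) (ξ η : Fin n → ℝ) :
    (U *ᵥ ξ) ⬝ᵥ (A *ᵥ (U *ᵥ η)) = ∑ j, ξ j * η j := by
  rw [dotProduct_mulVec_congr, h, Matrix.one_mulVec]; rfl

theorem dotProduct_mulVec_diagonal_of_congr {n : ℕ} {U B : Matrix (Fin n) (Fin n) ℝ}
    {M : Fin n → ℝ} (h : Uᵀ * B * U = Matrix.diagonal M) (ξ η : Fin n → ℝ) :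
    (U *ᵥ ξ) ⬝ᵥ (B *ᵥ (U *ᵥ η)) = ∑ j, M j * (ξ j * η j) := by
  rw [dotProduct_mulVec_congr, h]
  simp only [dotProduct, Matrix.mulVec_diagonal]
  exact Finset.sum_congr rfl fun j _ => by ring

theorem mulVec_eq_of_congr_diagonal {n : ℕ} {U A B : Matrix (Fin n) (Fin n) ℝ}
    {M : Fin n → ℝ} (hU : IsUnit U.det) (hA : Uᵀ * A * U = 1)
    (hB : Uᵀ * B * U = Matrix.diagonal M) (ξ : Fin n → ℝ) :
    B *ᵥ (U *ᵥ ξ) = A *ᵥ (U *ᵥ fun j => M j * ξ j) := by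
  have h1 : Uᵀ *ᵥ (B *ᵥ (U *ᵥ ξ)) = Uᵀ *ᵥ (A *ᵥ (U *ᵥ fun j => M j * ξ j)) := by
    simp only [Matrix.mulVec_mulVec]
    rw [← Matrix.mul_assoc, ← Matrix.mul_assoc, hA, hB, Matrix.one_mulVec]
    ext j
    rw [Matrix.mulVec_diagonal]
  exact Matrix.mulVec_injective_of_isUnit
    ((Matrix.isUnit_iff_isUnit_det _).mpr (by rwa [Matrix.det_transpose])) h1

theorem exists_mulVec_eq {n : ℕ} {U : Matrix (Fin n) (Fin n) ℝ} (hU : IsUnit U.det)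
    (x : Fin n → ℝ) : ∃ ξ, x = U *ᵥ ξ :=
  ⟨U⁻¹ *ᵥ x, by rw [Matrix.mulVec_mulVec, Matrix.mul_nonsing_inv _ hU, Matrix.one_mulVec]⟩

theorem dotProduct_mulVec_symm {n : ℕ} {A : Matrix (Fin n) (Fin n) ℝ} (hA : A.IsHermitian)
    (x y : Fin n → ℝ) : x ⬝ᵥ (A *ᵥ y) = y ⬝ᵥ (A *ᵥ x) := by
  have h : Aᵀ = A := by rw [← Matrix.conjTranspose_eq_transpose_of_trivial]; exact hA
  rw [Matrix.dotProduct_mulVec, ← Matrix.mulVec_transpose, h, dotProduct_comm]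

theorem dotProduct_mulVec_pos' {n : ℕ} {A : Matrix (Fin n) (Fin n) ℝ} (hA : A.PosDef)
    {x : Fin n → ℝ} (hx : x ≠ 0) : 0 < x ⬝ᵥ (A *ᵥ x) := by
  simpa using hA.dotProduct_mulVec_pos hx

/-- Expanding v in the eigenbasis, each coefficient is killed by the factor λ_j - ρ. This excludes
eigenvalues strictly between λ_i and λ_{i+1}, or above λ_n. -/
theorem exists_eq_of_eigenvector {n : ℕ} {A B : Matrix (Fin n) (Fin n) ℝ} (hB : B.PosDef)
    {lam : Fin n → ℝ} (hlam : PSD.IsEigenvalueEnumeration A B lam) {v : Fin n → ℝ} (hv : v ≠ 0)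
    {ρ : ℝ} (h : A *ᵥ v = ρ • (B *ᵥ v)) : ∃ j, ρ = lam j := by
  obtain ⟨-, u, hu, hev⟩ := hlam
  let b := basisOfLinearIndependentOfCardEqFinrank' u hu (by simp)
  have hb : ∀ j, b j = u j := fun j => by simp [b]
  have hsum : ∑ j, b.repr v j • u j = v := by
    conv_rhs => rw [← b.sum_repr v]
    exact Finset.sum_congr rfl fun j _ => by rw [hb]
  have h0 : B *ᵥ (∑ j, (b.repr v j * (lam j - ρ)) • u j) = 0 := by
    have h1 : A *ᵥ v = ∑ j, (b.repr v j * lam j) • (B *ᵥ u j) := by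
      conv_lhs => rw [← hsum]
      rw [Matrix.mulVec_sum]
      exact Finset.sum_congr rfl fun j _ => by rw [Matrix.mulVec_smul, hev, smul_smul]
    have h2 : ρ • (B *ᵥ v) = ∑ j, (b.repr v j * ρ) • (B *ᵥ u j) := by
      conv_lhs => rw [← hsum]
      rw [Matrix.mulVec_sum, Finset.smul_sum]
      exact Finset.sum_congr rfl fun j _ => by rw [Matrix.mulVec_smul, smul_smul, mul_comm]
    rw [Matrix.mulVec_sum, ← sub_eq_zero.mpr h, h1, h2, ← Finset.sum_sub_distrib]
    exact Finset.sum_congr rfl fun j _ => by rw [Matrix.mulVec_smul, mul_sub, sub_smul]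
  have h1 : ∑ j, (b.repr v j * (lam j - ρ)) • u j = 0 :=
    Matrix.mulVec_injective_of_isUnit hB.isUnit (by rw [h0, Matrix.mulVec_zero])
  have h2 := Fintype.linearIndependent_iff.mp hu _ h1
  by_contra! hcon
  apply hv
  rw [← hsum]
  refine Finset.sum_eq_zero fun j _ => ?_
  rcases mul_eq_zero.mp (h2 j) with h3 | h3
  · rw [h3, zero_smul]
  · exact absurd (sub_eq_zero.mp h3).symm (hcon j)

theorem eigenvalue_pos {n : ℕ} {A B : Matrix (Fin n) (Fin n) ℝ} (hA : A.PosDef) (hB : B.PosDef)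
    {lam : Fin n → ℝ} (hlam : PSD.IsEigenvalueEnumeration A B lam) (j : Fin n) : 0 < lam j := by
  obtain ⟨-, u, hu, hev⟩ := hlam
  have h1 := dotProduct_mulVec_pos' hA (hu.ne_zero j)
  have h2 := dotProduct_mulVec_pos' hB (hu.ne_zero j)
  rw [hev, dotProduct_smul, smul_eq_mul] at h1
  exact pos_of_mul_pos_left h1 h2.le

/-- The preconditioned residual approximates the residual in the energy norm. -/
theorem preconditioned_residual_error {n : ℕ} {A T : Matrix (Fin n) (Fin n) ℝ} {γ₁ γ₂ : ℝ}
    (hA : A.PosDef) (hT : T.PosDef) (h : PSD.SpectrallyEquivalent A T γ₁ γ₂) (g : Fin n → ℝ) :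
    ((2 / (γ₁ + γ₂)) • (T *ᵥ (A *ᵥ g)) - g) ⬝ᵥ
        (A *ᵥ ((2 / (γ₁ + γ₂)) • (T *ᵥ (A *ᵥ g)) - g)) ≤
      PSD.gam γ₁ γ₂ ^ 2 * (g ⬝ᵥ (A *ᵥ g)) := by
  obtain ⟨h1, h2, heq⟩ := h
  obtain ⟨U, L, hU, hUA, hUT⟩ := exists_congruence_diagonal hA hT.inv.isHermitian
  obtain ⟨π, hπ⟩ := exists_mulVec_eq hU (T *ᵥ (A *ᵥ g))
  have hTu : IsUnit T.det := (Matrix.isUnit_iff_isUnit_det _).mp hT.isUnit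
  -- L_j is an eigenvalue of T⁻¹ relative to A, hence lies in [1/γ₂, 1/γ₁]. The scaling 2 / (γ₁ +
  -- γ₂) makes the relative error at the two endpoints equal in size.
  have hL : ∀ j, γ₁ * L j ≤ 1 ∧ 1 ≤ γ₂ * L j := by
    intro j
    have h := heq (U *ᵥ Pi.single j 1)
    rw [dotProduct_mulVec_one_of_congr hUA, dotProduct_mulVec_diagonal_of_congr hUT] at h
    simpa [Pi.single_apply] using h
  have hg : g = U *ᵥ fun j => L j * π j := by
    apply Matrix.mulVec_injective_of_isUnit hA.isUnit
    change A *ᵥ g = A *ᵥ (U *ᵥ fun j => L j * π j)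
    rw [← mulVec_eq_of_congr_diagonal hU hUA hUT, ← hπ, Matrix.mulVec_mulVec,
      Matrix.nonsing_inv_mul _ hTu, Matrix.one_mulVec]
  have hd : (2 / (γ₁ + γ₂)) • (T *ᵥ (A *ᵥ g)) - g =
      U *ᵥ fun j => (2 / (γ₁ + γ₂)) * π j - L j * π j := by
    rw [hπ]
    conv_lhs => rw [hg]
    rw [← Matrix.mulVec_smul, ← Matrix.mulVec_sub]
    rfl
  rw [hd, dotProduct_mulVec_one_of_congr hUA]
  conv_rhs => rw [hg]
  rw [dotProduct_mulVec_one_of_congr hUA, Finset.mul_sum]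
  refine Finset.sum_le_sum fun j _ => ?_
  obtain ⟨h3, h4⟩ := hL j
  have h5 : 0 < γ₁ + γ₂ := by positivity
  unfold PSD.gam
  rw [div_pow, div_mul_eq_mul_div ((γ₂ - γ₁) ^ 2), le_div_iff₀ (by positivity)]
  have h6 : (2 / (γ₁ + γ₂) * π j - L j * π j) * (2 / (γ₁ + γ₂) * π j - L j * π j) *
      (γ₁ + γ₂) ^ 2 = (2 - (γ₁ + γ₂) * L j) ^ 2 * π j ^ 2 := by
    field_simp
  rw [h6]
  -- (γ₂ - γ₁)² L² - (2 - (γ₁ + γ₂) L)² = 4 (1 - γ₁ L)(γ₂ L - 1).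
  have h7 : 0 ≤ (1 - γ₁ * L j) * (γ₂ * L j - 1) * π j ^ 2 :=
    mul_nonneg (mul_nonneg (by linarith) (by linarith)) (sq_nonneg _)
  nlinarith

/-! ### The inverse Rayleigh quotient along the search line. -/

theorem mu_smul {n : ℕ} (A B : Matrix (Fin n) (Fin n) ℝ) {c : ℝ} (hc : c ≠ 0) (x : Fin n → ℝ) :
    PSD.mu A B (c • x) = PSD.mu A B x := by
  simp only [PSD.mu, Matrix.mulVec_smul, dotProduct_smul, smul_dotProduct, smul_eq_mul]
  rw [mul_div_mul_left _ _ hc, mul_div_mul_left _ _ hc]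

theorem mu_pos {n : ℕ} {A B : Matrix (Fin n) (Fin n) ℝ} (hA : A.PosDef) (hB : B.PosDef)
    {x : Fin n → ℝ} (hx : x ≠ 0) : 0 < PSD.mu A B x :=
  div_pos (dotProduct_mulVec_pos' hB hx) (dotProduct_mulVec_pos' hA hx)

theorem dotProduct_residual {n : ℕ} {A B : Matrix (Fin n) (Fin n) ℝ} (hA : A.PosDef)
    {x : Fin n → ℝ} (hx : x ≠ 0) : x ⬝ᵥ (B *ᵥ x - PSD.mu A B x • (A *ᵥ x)) = 0 := by
  rw [dotProduct_sub, dotProduct_smul, smul_eq_mul, PSD.mu,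
    div_mul_cancel₀ _ (dotProduct_mulVec_pos' hA hx).ne', sub_self]

/-- The line through `x` along a preconditioned orthogonal vector avoids the origin. -/
theorem add_smul_mulVec_ne_zero {n : ℕ} {T : Matrix (Fin n) (Fin n) ℝ} (hT : T.PosDef)
    {x r : Fin n → ℝ} (hx : x ≠ 0) (hr : x ⬝ᵥ r = 0) (s : ℝ) : x + s • (T *ᵥ r) ≠ 0 := by
  intro h
  have h1 : s * (r ⬝ᵥ (T *ᵥ r)) = 0 := by
    have h2 := congrArg (fun v => r ⬝ᵥ v) h
    simpa [dotProduct_add, dotProduct_comm r x, hr] using h2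
  rcases mul_eq_zero.mp h1 with h2 | h2
  · rw [h2, zero_smul, add_zero] at h
    exact hx h
  · have hr0 : r = 0 := by
      by_contra hne
      exact (dotProduct_mulVec_pos' hT hne).ne' h2
    rw [hr0, Matrix.mulVec_zero, smul_zero, add_zero] at h
    exact hx h

theorem muDirection_line_ne_zero {n : ℕ} {A B T : Matrix (Fin n) (Fin n) ℝ} (hA : A.PosDef)
    (hT : T.PosDef) {x : Fin n → ℝ} (hx : x ≠ 0) (s : ℝ) :
    x + s • PSD.muDirection A B T x ≠ 0 :=
  add_smul_mulVec_ne_zero hT hx (dotProduct_residual hA hx) s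

theorem continuous_quadratic_line {n : ℕ} (A : Matrix (Fin n) (Fin n) ℝ) (x d : Fin n → ℝ) :
    Continuous fun p : ℝ × ℝ => (p.1 • x + p.2 • d) ⬝ᵥ (A *ᵥ (p.1 • x + p.2 • d)) := by
  simp only [Matrix.mulVec_add, Matrix.mulVec_smul, dotProduct_add, add_dotProduct,
    smul_dotProduct, dotProduct_smul, smul_eq_mul]
  fun_prop

theorem continuousAt_mu_line {n : ℕ} {A : Matrix (Fin n) (Fin n) ℝ} (B : Matrix (Fin n) (Fin n) ℝ)
    (hA : A.PosDef) (x d : Fin n → ℝ) {p : ℝ × ℝ} (h : p.1 • x + p.2 • d ≠ 0) :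
    ContinuousAt (fun p : ℝ × ℝ => PSD.mu A B (p.1 • x + p.2 • d)) p :=
  (continuous_quadratic_line B x d).continuousAt.div (continuous_quadratic_line A x d).continuousAt
    (dotProduct_mulVec_pos' hA h).ne'

/-- If the inverse Rayleigh quotient has no maximizer on a line, its supremum is the value at the
direction of the line. -/
theorem mu_line_le_of_no_maximizer {n : ℕ} {A B : Matrix (Fin n) (Fin n) ℝ} (hA : A.PosDef)
    {x d : Fin n → ℝ} (hd : d ≠ 0) (hline : ∀ s : ℝ, x + s • d ≠ 0)
    (hno : ∀ s : ℝ, ∃ t : ℝ, PSD.mu A B (x + s • d) < PSD.mu A B (x + t • d)) (s : ℝ) :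
    PSD.mu A B (x + s • d) ≤ PSD.mu A B d := by
  by_contra! hs
  have hcont : Continuous fun s : ℝ => PSD.mu A B (x + s • d) := by
    rw [continuous_iff_continuousAt]
    intro t
    have h := continuousAt_mu_line B hA x d (p := (1, t)) (by simpa using hline t)
    have h2 : ContinuousAt (fun t : ℝ => ((1 : ℝ), t)) t := by fun_prop
    simpa [Function.comp_def] using ContinuousAt.comp (f := fun t : ℝ => ((1 : ℝ), t)) h h2
  -- By homogeneity the value at x + s d is the value at s⁻¹ x + d, which tends to that at d. A
  -- value above this limit would give a maximizer by compactness.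
  have hlim : Tendsto (fun s : ℝ => PSD.mu A B (x + s • d)) (cocompact ℝ)
      (𝓝 (PSD.mu A B d)) := by
    have h := continuousAt_mu_line B hA x d (p := (0, 1)) (by simpa using hd)
    have hinv : Tendsto (fun s : ℝ => (s⁻¹, (1 : ℝ))) (cocompact ℝ) (𝓝 (0, 1)) := by
      rw [← Metric.cobounded_eq_cocompact, nhds_prod_eq]
      exact tendsto_inv₀_cobounded.prodMk tendsto_const_nhds
    have h3 := h.tendsto.comp hinv
    simp only [zero_smul, one_smul, zero_add] at h3
    refine h3.congr' ?_
    have : ∀ᶠ s : ℝ in cocompact ℝ, s ≠ 0 :=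
      isCompact_singleton.compl_mem_cocompact
    filter_upwards [this] with t ht
    have : x + t • d = t • (t⁻¹ • x + (1 : ℝ) • d) := by
      rw [smul_add, smul_smul, mul_inv_cancel₀ ht, one_smul, one_smul]
    rw [this, mu_smul A B ht]
    rfl
  have hev : ∀ᶠ t in cocompact ℝ, PSD.mu A B (x + t • d) ≤ PSD.mu A B (x + s • d) :=
    (hlim.eventually_lt_const hs).mono fun _ h => h.le
  obtain ⟨t, ht⟩ := hcont.exists_forall_ge' s hev
  obtain ⟨t', ht'⟩ := hno t
  exact (ht t').not_gt ht'

/-- Finite and unbounded steps are merged here: the estimate only uses that `x'` is nonzero and at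
least as good as every point of the line. -/
theorem mu_iterate_optimal {n : ℕ} {A B T : Matrix (Fin n) (Fin n) ℝ} (hA : A.PosDef)
    (hB : B.PosDef) (hT : T.PosDef) {x x' : Fin n → ℝ} (hx : x ≠ 0)
    (h : PSD.IsMuIterate A B T x x' ∨ PSD.IsMuUnboundedStepIterate A B T x x') :
    x' ≠ 0 ∧ ∀ s : ℝ, PSD.mu A B (x + s • PSD.muDirection A B T x) ≤ PSD.mu A B x' := by
  have hm : PSD.mu A B x ≠ 0 := (mu_pos hA hB hx).ne'
  have hscale : ∀ s : ℝ, PSD.mu A B x • x + s • PSD.muDirection A B T x =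
      PSD.mu A B x • (x + (s / PSD.mu A B x) • PSD.muDirection A B T x) := by
    intro s
    rw [smul_add, smul_smul, mul_div_cancel₀ _ hm]
  have hline := muDirection_line_ne_zero (B := B) hA hT hx
  rcases h with ⟨θ, hmax, hx'⟩ | ⟨hno, c, hc, hx'⟩
  · have e : x' = x + (θ / PSD.mu A B x) • PSD.muDirection A B T x := by
      rw [hscale] at hx'
      exact smul_right_injective _ hm hx'
    refine ⟨by rw [e]; exact hline _, fun s => ?_⟩
    have := hmax (s * PSD.mu A B x)
    rwa [hscale, hscale, mu_smul A B hm, mu_smul A B hm, ← e, mul_div_cancel_right₀ _ hm] at this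
  · have hd : PSD.muDirection A B T x ≠ 0 := by
      intro h0
      obtain ⟨t, ht⟩ := hno 0
      rw [h0, smul_zero, smul_zero] at ht
      exact lt_irrefl _ ht
    refine ⟨by rw [hx']; exact smul_ne_zero hc hd, fun s => ?_⟩
    rw [hx', mu_smul A B hc]
    refine mu_line_le_of_no_maximizer hA hd hline (fun s => ?_) s
    obtain ⟨t, ht⟩ := hno (s * PSD.mu A B x)
    refine ⟨t / PSD.mu A B x, ?_⟩
    rwa [hscale, hscale, mu_smul A B hm, mu_smul A B hm, mul_div_cancel_right₀ _ hm] at ht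

/-! ### The convergence estimate for the inverse Rayleigh quotient. -/

/-- The estimate for a point that is at least as good as the whole search line, with a strict upper
bound `γ` for the quality of the preconditioner. -/
theorem mu_estimate_of_gam_lt {n : ℕ} {A B T : Matrix (Fin n) (Fin n) ℝ} (hA : A.PosDef)
    (hB : B.PosDef) (hT : T.PosDef) {γ₁ γ₂ p q r γ : ℝ}
    (hequiv : PSD.SpectrallyEquivalent A T γ₁ γ₂) (hgam : |PSD.gam γ₁ γ₂| ≤ γ)
    (hγ0 : 0 < γ) (hγ1 : γ < 1) (hrq : r ≤ q)
    (hspec : ∀ (v : Fin n → ℝ) (ρ : ℝ), v ≠ 0 → B *ᵥ v = ρ • (A *ᵥ v) → p ≤ ρ ∨ (r ≤ ρ ∧ ρ ≤ q))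
    {x : Fin n → ℝ} (hx : x ≠ 0) {μ' : ℝ}
    (hopt : ∀ s : ℝ, PSD.mu A B (x + s • PSD.muDirection A B T x) ≤ μ')
    (hq : q < PSD.mu A B x) (hp : PSD.mu A B x < p) (hμ' : μ' < p) :
    (p - μ') / (μ' - q) ≤ PSD.sigma (PSD.kappaMu p q r) γ ^ 2 *
      ((p - PSD.mu A B x) / (PSD.mu A B x - q)) := by
  obtain ⟨U, M, hU, hUA, hUB⟩ := exists_congruence_diagonal hA hB.isHermitian
  obtain ⟨X, hX⟩ := exists_mulVec_eq hU x
  set m := PSD.mu A B x with hm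
  have hres : B *ᵥ x - m • (A *ᵥ x) = A *ᵥ (U *ᵥ fun j => (M j - m) * X j) := by
    rw [hX, mulVec_eq_of_congr_diagonal hU hUA hUB, ← Matrix.mulVec_smul, ← Matrix.mulVec_sub,
      ← Matrix.mulVec_smul, ← Matrix.mulVec_sub]
    congr 2
    ext j
    simp only [Pi.sub_apply, Pi.smul_apply, smul_eq_mul]
    ring
  -- The scaling is harmless, since the step length along the line is free.
  obtain ⟨D, hD⟩ := exists_mulVec_eq hU ((2 / (γ₁ + γ₂)) • PSD.muDirection A B T x)
  have hM : ∀ j, p ≤ M j ∨ (r ≤ M j ∧ M j ≤ q) := by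
    intro j
    refine hspec (U *ᵥ Pi.single j 1) (M j) ?_ ?_
    · intro h0
      have h1 := dotProduct_mulVec_one_of_congr hUA (Pi.single j 1) (Pi.single j 1)
      rw [h0, zero_dotProduct] at h1
      simp [Pi.single_apply] at h1
    · rw [mulVec_eq_of_congr_diagonal hU hUA hUB, ← Matrix.mulVec_smul, ← Matrix.mulVec_smul]
      congr 2
      ext k
      by_cases hk : k = j
      · subst hk; simp
      · simp [hk]
  have horth : ∑ j, (M j - m) * X j ^ 2 = 0 := by
    have h := dotProduct_residual (B := B) hA hx
    rw [← hm, hres] at h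
    conv_lhs at h => rw [hX]
    rw [dotProduct_mulVec_one_of_congr hUA] at h
    rw [← h]
    exact Finset.sum_congr rfl fun j _ => by ring
  have herr : ∑ j, (D j - (M j - m) * X j) ^ 2 ≤ γ ^ 2 * ∑ j, ((M j - m) * X j) ^ 2 := by
    have h := preconditioned_residual_error hA hT hequiv (U *ᵥ fun j => (M j - m) * X j)
    rw [← hres] at h
    change ((2 / (γ₁ + γ₂)) • PSD.muDirection A B T x - _) ⬝ᵥ
      (A *ᵥ ((2 / (γ₁ + γ₂)) • PSD.muDirection A B T x - _)) ≤ _ at h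
    rw [hD, ← Matrix.mulVec_sub, dotProduct_mulVec_one_of_congr hUA, hres,
      dotProduct_mulVec_one_of_congr hUA] at h
    simp only [Pi.sub_apply, ← pow_two] at h
    refine h.trans ?_
    refine mul_le_mul_of_nonneg_right ?_ (Finset.sum_nonneg fun j _ => sq_nonneg _)
    exact sq_le_sq.mpr (hgam.trans (le_abs_self γ))
  obtain ⟨θ, t, ht0, ht, hnonneg⟩ := exists_good_step hrq hq hp hγ0 hγ1 hM horth herr
  have hstep : m + t ≤ μ' := by
    refine le_trans ?_ (hopt (θ * (2 / (γ₁ + γ₂))))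
    have hne := muDirection_line_ne_zero (B := B) hA hT hx (θ * (2 / (γ₁ + γ₂)))
    have hy : x + (θ * (2 / (γ₁ + γ₂))) • PSD.muDirection A B T x =
        U *ᵥ fun j => X j + θ * D j := by
      rw [mul_smul, hD]
      conv_lhs => rw [hX]
      rw [← Matrix.mulVec_smul, ← Matrix.mulVec_add]
      rfl
    unfold PSD.mu
    rw [le_div_iff₀ (dotProduct_mulVec_pos' hA hne), hy, dotProduct_mulVec_one_of_congr hUA,
      dotProduct_mulVec_diagonal_of_congr hUB, ← sub_nonneg, Finset.mul_sum,
      ← Finset.sum_sub_distrib]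
    refine hnonneg.trans_eq (Finset.sum_congr rfl fun j _ => ?_)
    ring
  have e : PSD.sigma (PSD.kappaMu p q r) γ ^ 2 * ((p - m) / (m - q)) =
      (p - m - t) / (m - q + t) := by
    rw [← mul_div_assoc, div_eq_div_iff (by linarith) (by linarith), ht]
    ring
  rw [e, div_le_div_iff₀ (by linarith) (by linarith)]
  exact mul_le_mul (by linarith) (by linarith) (by linarith) (by linarith)

theorem gam_nonneg {n : ℕ} (hn : 0 < n) {A T : Matrix (Fin n) (Fin n) ℝ} (hT : T.PosDef)
    {γ₁ γ₂ : ℝ} (h : PSD.SpectrallyEquivalent A T γ₁ γ₂) : 0 ≤ PSD.gam γ₁ γ₂ := by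
  obtain ⟨h1, h2, heq⟩ := h
  have hne : (Pi.single ⟨0, hn⟩ 1 : Fin n → ℝ) ≠ 0 := by simp
  have hpos := dotProduct_mulVec_pos' hT.inv hne
  have h3 := le_of_mul_le_mul_right ((heq _).1.trans (heq _).2) hpos
  exact div_nonneg (by linarith) (by linarith)

theorem gam_lt_one {γ₁ γ₂ : ℝ} (h1 : 0 < γ₁) (h2 : 0 < γ₂) : PSD.gam γ₁ γ₂ < 1 := by
  unfold PSD.gam
  rw [div_lt_one (by positivity)]
  linarith

theorem kappaMu_mem_Ico {p q r : ℝ} (hrq : r ≤ q) (hqp : q < p) :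
    PSD.kappaMu p q r ∈ Set.Ico 0 1 := by
  have h : 0 < p - r := by linarith
  constructor
  · exact div_nonneg (by linarith) h.le
  · unfold PSD.kappaMu
    rw [div_lt_one h]
    linarith

/-- The convergence estimate in terms of the inverse Rayleigh quotient. -/
theorem mu_estimate {n : ℕ} (hn : 0 < n) {A B T : Matrix (Fin n) (Fin n) ℝ} (hA : A.PosDef)
    (hB : B.PosDef) (hT : T.PosDef) {γ₁ γ₂ p q r : ℝ}
    (hequiv : PSD.SpectrallyEquivalent A T γ₁ γ₂) (hrq : r ≤ q)
    (hspec : ∀ (v : Fin n → ℝ) (ρ : ℝ), v ≠ 0 → B *ᵥ v = ρ • (A *ᵥ v) → p ≤ ρ ∨ (r ≤ ρ ∧ ρ ≤ q))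
    {x x' : Fin n → ℝ} (hx : x ≠ 0)
    (hx' : PSD.IsMuIterate A B T x x' ∨ PSD.IsMuUnboundedStepIterate A B T x x')
    (hq : q < PSD.mu A B x) (hp : PSD.mu A B x ≤ p) :
    x' ≠ 0 ∧ PSD.mu A B x ≤ PSD.mu A B x' ∧ (p ≤ PSD.mu A B x' ∨
      (p - PSD.mu A B x') / (PSD.mu A B x' - q) ≤
        PSD.sigma (PSD.kappaMu p q r) (PSD.gam γ₁ γ₂) ^ 2 *
          ((p - PSD.mu A B x) / (PSD.mu A B x - q))) := by
  obtain ⟨hne, hopt⟩ := mu_iterate_optimal hA hB hT hx hx'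
  have hmono : PSD.mu A B x ≤ PSD.mu A B x' := by simpa using hopt 0
  refine ⟨hne, hmono, ?_⟩
  rcases le_or_gt p (PSD.mu A B x') with h | h
  · exact Or.inl h
  right
  have hg0 := gam_nonneg hn hT hequiv
  have hg1 := gam_lt_one hequiv.1 hequiv.2.1
  obtain ⟨hκ0, hκ1⟩ := kappaMu_mem_Ico hrq (hq.trans_le hp)
  have hcont : ContinuousAt (fun γ => PSD.sigma (PSD.kappaMu p q r) γ ^ 2 *
      ((p - PSD.mu A B x) / (PSD.mu A B x - q))) (PSD.gam γ₁ γ₂) := by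
    have hden : (2 - PSD.kappaMu p q r) + PSD.gam γ₁ γ₂ * PSD.kappaMu p q r ≠ 0 := by
      have := mul_nonneg hg0 hκ0
      linarith
    unfold PSD.sigma
    fun_prop (disch := exact hden)
  -- The multiplier construction divides by γ, so γ = 0 is reached as a limit: the bound holds for
  -- all γ in (`gam γ₁ γ₂`, 1), and σ is continuous in γ.
  refine ge_of_tendsto (hcont.tendsto.mono_left nhdsWithin_le_nhds :
    Tendsto _ (𝓝[>] (PSD.gam γ₁ γ₂)) _) ?_
  filter_upwards [Ioo_mem_nhdsGT hg1] with γ hγ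
  exact mu_estimate_of_gam_lt hA hB hT hequiv (by rw [abs_of_nonneg hg0]; exact hγ.1.le)
    (hg0.trans_lt hγ.1) hγ.2 hrq hspec hx hopt hq (hmono.trans_lt h) h

/-! ### Sharpness: the extremal three-dimensional configuration. -/

/-- A preconditioner with prescribed action on an `A`-orthonormal pair. -/
theorem exists_preconditioner {n : ℕ} {A : Matrix (Fin n) (Fin n) ℝ} (hA : A.PosDef)
    {γ₁ γ₂ τ : ℝ} (h1 : 0 < γ₁) (hτ1 : γ₁ ≤ τ) (hτ2 : τ ≤ γ₂) {u w : Fin n → ℝ}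
    (huu : u ⬝ᵥ (A *ᵥ u) = 1) (hww : w ⬝ᵥ (A *ᵥ w) = 1) (huw : u ⬝ᵥ (A *ᵥ w) = 0) :
    ∃ T : Matrix (Fin n) (Fin n) ℝ, T.PosDef ∧ PSD.SpectrallyEquivalent A T γ₁ γ₂ ∧
      T *ᵥ (A *ᵥ u) = τ • u ∧ T *ᵥ (A *ᵥ w) = γ₂ • w ∧
      ∀ v, u ⬝ᵥ (A *ᵥ v) = 0 → w ⬝ᵥ (A *ᵥ v) = 0 → T *ᵥ (A *ᵥ v) = γ₁ • v := by
  have hτ : 0 < τ := h1.trans_le hτ1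
  have h2 : 0 < γ₂ := hτ.trans_le hτ2
  have hsymm := dotProduct_mulVec_symm hA.isHermitian
  -- W is T⁻¹: γ₁⁻¹ A with a rank-two correction giving the relative eigenvalues τ⁻¹ on u and γ₂⁻¹
  -- on w. Bessel's inequality bounds it between γ₂⁻¹ A and γ₁⁻¹ A.
  set W : Matrix (Fin n) (Fin n) ℝ := γ₁⁻¹ • A +
    (τ⁻¹ - γ₁⁻¹) • Matrix.vecMulVec (A *ᵥ u) (A *ᵥ u) +
    (γ₂⁻¹ - γ₁⁻¹) • Matrix.vecMulVec (A *ᵥ w) (A *ᵥ w) with hW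
  have hWz : ∀ z, W *ᵥ z = γ₁⁻¹ • (A *ᵥ z) + ((τ⁻¹ - γ₁⁻¹) * (u ⬝ᵥ (A *ᵥ z))) • (A *ᵥ u) +
      ((γ₂⁻¹ - γ₁⁻¹) * (w ⬝ᵥ (A *ᵥ z))) • (A *ᵥ w) := by
    intro z
    rw [hW, Matrix.add_mulVec, Matrix.add_mulVec, Matrix.smul_mulVec, Matrix.smul_mulVec,
      Matrix.smul_mulVec, Matrix.vecMulVec_mulVec, Matrix.vecMulVec_mulVec,
      dotProduct_comm (A *ᵥ u), dotProduct_comm (A *ᵥ w), hsymm z u, hsymm z w]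
    simp [smul_smul]
  have hquad : ∀ z, z ⬝ᵥ (W *ᵥ z) = γ₁⁻¹ * (z ⬝ᵥ (A *ᵥ z)) +
      (τ⁻¹ - γ₁⁻¹) * (u ⬝ᵥ (A *ᵥ z)) ^ 2 + (γ₂⁻¹ - γ₁⁻¹) * (w ⬝ᵥ (A *ᵥ z)) ^ 2 := by
    intro z
    rw [hWz, dotProduct_add, dotProduct_add, dotProduct_smul, dotProduct_smul, dotProduct_smul,
      hsymm z u, hsymm z w]
    simp only [smul_eq_mul]
    ring
  have hbessel : ∀ z, (u ⬝ᵥ (A *ᵥ z)) ^ 2 + (w ⬝ᵥ (A *ᵥ z)) ^ 2 ≤ z ⬝ᵥ (A *ᵥ z) := by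
    intro z
    have h := hA.posSemidef.dotProduct_mulVec_nonneg
      (z - (u ⬝ᵥ (A *ᵥ z)) • u - (w ⬝ᵥ (A *ᵥ z)) • w)
    simp only [star_trivial, Matrix.mulVec_sub, Matrix.mulVec_smul, dotProduct_sub,
      sub_dotProduct, smul_dotProduct, dotProduct_smul, smul_eq_mul, huu, hww, huw,
      hsymm w u, hsymm z u, hsymm z w] at h
    nlinarith
  have hτi : γ₂⁻¹ ≤ τ⁻¹ := inv_anti₀ hτ hτ2
  have hτi' : τ⁻¹ ≤ γ₁⁻¹ := inv_anti₀ h1 hτ1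
  have hlow : ∀ z, γ₂⁻¹ * (z ⬝ᵥ (A *ᵥ z)) ≤ z ⬝ᵥ (W *ᵥ z) := by
    intro z
    rw [hquad]
    have e1 := mul_le_mul_of_nonneg_left (hbessel z) (show 0 ≤ γ₁⁻¹ - γ₂⁻¹ by linarith)
    have e2 : 0 ≤ (τ⁻¹ - γ₂⁻¹) * (u ⬝ᵥ (A *ᵥ z)) ^ 2 :=
      mul_nonneg (by linarith) (sq_nonneg _)
    linarith
  have hupp : ∀ z, z ⬝ᵥ (W *ᵥ z) ≤ γ₁⁻¹ * (z ⬝ᵥ (A *ᵥ z)) := by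
    intro z
    rw [hquad]
    have e1 : 0 ≤ (γ₁⁻¹ - τ⁻¹) * (u ⬝ᵥ (A *ᵥ z)) ^ 2 := mul_nonneg (by linarith) (sq_nonneg _)
    have e2 : 0 ≤ (γ₁⁻¹ - γ₂⁻¹) * (w ⬝ᵥ (A *ᵥ z)) ^ 2 :=
      mul_nonneg (by linarith) (sq_nonneg _)
    linarith
  have hWpd : W.PosDef := by
    refine Matrix.PosDef.of_dotProduct_mulVec_pos ?_ fun z hz => ?_
    · have hAT : Aᵀ = A := by
        rw [← Matrix.conjTranspose_eq_transpose_of_trivial]; exact hA.isHermitian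
      rw [Matrix.IsHermitian, Matrix.conjTranspose_eq_transpose_of_trivial, hW,
        Matrix.transpose_add, Matrix.transpose_add, Matrix.transpose_smul, Matrix.transpose_smul,
        Matrix.transpose_smul, Matrix.transpose_vecMulVec, Matrix.transpose_vecMulVec, hAT]
    · rw [star_trivial]
      exact (mul_pos (inv_pos.mpr h2) (dotProduct_mulVec_pos' hA hz)).trans_le (hlow z)
  have hWu : IsUnit W.det := (Matrix.isUnit_iff_isUnit_det _).mp hWpd.isUnit
  have hinv : ∀ (c : ℝ) (z : Fin n → ℝ), c ≠ 0 → W *ᵥ z = c⁻¹ • (A *ᵥ z) →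
      W⁻¹ *ᵥ (A *ᵥ z) = c • z := by
    intro c z hc h
    have h3 : A *ᵥ z = c • (W *ᵥ z) := by rw [h, smul_smul, mul_inv_cancel₀ hc, one_smul]
    rw [h3, Matrix.mulVec_smul, Matrix.mulVec_mulVec, Matrix.nonsing_inv_mul _ hWu,
      Matrix.one_mulVec]
  refine ⟨W⁻¹, hWpd.inv, ⟨h1, h2, fun z => ?_⟩, hinv _ _ hτ.ne' ?_, hinv _ _ h2.ne' ?_,
    fun v hu hw => hinv _ _ h1.ne' ?_⟩
  · rw [Matrix.nonsing_inv_nonsing_inv _ hWu]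
    constructor
    · have := mul_le_mul_of_nonneg_left (hupp z) h1.le
      rwa [← mul_assoc, mul_inv_cancel₀ h1.ne', one_mul] at this
    · have := mul_le_mul_of_nonneg_left (hlow z) h2.le
      rwa [← mul_assoc, mul_inv_cancel₀ h2.ne', one_mul] at this
  · rw [hWz, huu, hsymm w u, huw, mul_zero, zero_smul, add_zero, mul_one, ← add_smul]
    congr 1; ring
  · rw [hWz, huw, hww, mul_zero, zero_smul, add_zero, mul_one, ← add_smul]
    congr 1; ring
  · rw [hWz, hu, hw, mul_zero, mul_zero, zero_smul, zero_smul, add_zero, add_zero]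

/-- An explicit optimal step when the search direction is `A`-orthogonal to the iterate. -/
theorem exists_isMuIterate {n : ℕ} {A B T : Matrix (Fin n) (Fin n) ℝ} (hA : A.PosDef)
    (hB : B.PosDef) (hT : T.PosDef) {x d : Fin n → ℝ} {s t Nx Nd R Y : ℝ} (hx : x ≠ 0)
    (hd : PSD.muDirection A B T x = d) (hs : PSD.mu A B x = s)
    (hxx : x ⬝ᵥ (A *ᵥ x) = Nx) (hxd : x ⬝ᵥ (A *ᵥ d) = 0) (hdd : d ⬝ᵥ (A *ᵥ d) = Nd)
    (hR : x ⬝ᵥ (B *ᵥ d) = R) (hY : d ⬝ᵥ (B *ᵥ d) = s * Nd + Y) (hR0 : R ≠ 0) (ht : 0 < t)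
    (hroot : Nx * Nd * t ^ 2 - Nx * Y * t - R ^ 2 = 0) :
    ∃ k : ℝ, PSD.IsMuIterate A B T x (x + k • d) ∧ PSD.mu A B (x + k • d) = s + t := by
  have hNx : 0 < Nx := hxx ▸ dotProduct_mulVec_pos' hA hx
  have hs0 : s ≠ 0 := hs ▸ (mu_pos hA hB hx).ne'
  have hG : 0 < t * Nd - Y := by
    have h1 : 0 < t * Nx * (t * Nd - Y) := by
      have : t * Nx * (t * Nd - Y) = R ^ 2 := by linear_combination hroot
      rw [this]; positivity
    exact pos_of_mul_pos_right h1 (by positivity)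
  have hBx : x ⬝ᵥ (B *ᵥ x) = s * Nx := by
    rw [← hs, ← hxx, PSD.mu, div_mul_cancel₀ _ (dotProduct_mulVec_pos' hA hx).ne']
  have hsA := dotProduct_mulVec_symm hA.isHermitian d x
  have hsB := dotProduct_mulVec_symm hB.isHermitian d x
  have hden : ∀ k : ℝ, (x + k • d) ⬝ᵥ (A *ᵥ (x + k • d)) = Nx + k ^ 2 * Nd := by
    intro k
    simp only [Matrix.mulVec_add, Matrix.mulVec_smul, dotProduct_add, add_dotProduct,
      smul_dotProduct, dotProduct_smul, smul_eq_mul, hxx, hxd, hdd, hsA]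
    ring
  have hnum : ∀ k : ℝ, (x + k • d) ⬝ᵥ (B *ᵥ (x + k • d)) =
      s * Nx + 2 * k * R + k ^ 2 * (s * Nd + Y) := by
    intro k
    simp only [Matrix.mulVec_add, Matrix.mulVec_smul, dotProduct_add, add_dotProduct,
      smul_dotProduct, dotProduct_smul, smul_eq_mul, hBx, hR, hY, hsB]
    ring
  have hpos : ∀ k : ℝ, 0 < Nx + k ^ 2 * Nd := by
    intro k
    rw [← hden, ← hd]
    exact dotProduct_mulVec_pos' hA (muDirection_line_ne_zero hA hT hx k)
  -- `hroot` makes the 2 × 2 Ritz determinant vanish at s + t, so the gap to s + t is a perfect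
  -- square in k up to the positive factor t Nd - Y. Its zero gives the optimal step.
  have hkey : ∀ k : ℝ, (t * Nd - Y) * ((s + t) * (Nx + k ^ 2 * Nd) -
      (s * Nx + 2 * k * R + k ^ 2 * (s * Nd + Y))) = (R - k * (t * Nd - Y)) ^ 2 := by
    intro k
    linear_combination hroot
  have hle : ∀ k : ℝ, PSD.mu A B (x + k • d) ≤ s + t := by
    intro k
    rw [PSD.mu, hden, hnum, div_le_iff₀ (hpos k), ← sub_nonneg]
    refine nonneg_of_mul_nonneg_right ?_ hG
    rw [hkey]
    positivity
  obtain ⟨k, hk⟩ : ∃ k, k = R / (t * Nd - Y) := ⟨_, rfl⟩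
  have heq : PSD.mu A B (x + k • d) = s + t := by
    rw [PSD.mu, hden, hnum, div_eq_iff (hpos k).ne', eq_comm, ← sub_eq_zero]
    have h0 := hkey k
    rw [hk, div_mul_cancel₀ _ hG.ne', sub_self, zero_pow two_ne_zero, ← hk] at h0
    exact (mul_eq_zero.mp h0).resolve_left hG.ne'
  have hscale : ∀ j : ℝ, s • x + j • d = s • (x + (j / s) • d) := by
    intro j
    rw [smul_add, smul_smul, mul_div_cancel₀ _ hs0]
  refine ⟨k, ⟨s * k, fun j => ?_, ?_⟩, heq⟩
  · rw [hs, hd, hscale, hscale, mu_smul A B hs0, mu_smul A B hs0, mul_div_cancel_left₀ _ hs0, heq]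
    exact hle _
  · rw [hs, hd, hscale, mul_div_cancel_left₀ _ hs0]

/-- The three-dimensional configuration on which the estimate is asymptotically attained. -/
theorem exists_extremal_step {n : ℕ} {A B : Matrix (Fin n) (Fin n) ℝ} (hA : A.PosDef)
    (hB : B.PosDef) {γ₁ γ₂ p q r s a b c K τ g : ℝ} (h1 : 0 < γ₁) (h12 : γ₁ ≤ γ₂) (hrq : r ≤ q)
    (hs : s ∈ Set.Ioo q p) (ha : a = p - s) (hb : b = s - q) (hc : c = s - r)
    (hK : K = γ₁ * b + γ₂ * c) (hτ : τ = γ₁ * γ₂ * (b + c) / K)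
    {u v w : Fin n → ℝ} (hu : B *ᵥ u = p • (A *ᵥ u)) (hv : B *ᵥ v = q • (A *ᵥ v))
    (hw : B *ᵥ w = r • (A *ᵥ w)) (huu : u ⬝ᵥ (A *ᵥ u) = 1) (hvv : v ⬝ᵥ (A *ᵥ v) = 1)
    (hww : w ⬝ᵥ (A *ᵥ w) = 1) (huv : u ⬝ᵥ (A *ᵥ v) = 0) (huw : u ⬝ᵥ (A *ᵥ w) = 0)
    (hvw : v ⬝ᵥ (A *ᵥ w) = 0) (hg : 0 < g)
    (hroot : (1 + a * (γ₂ * c / (b * K) + γ₁ * b / (c * K))) *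
        (τ ^ 2 * a + γ₁ * γ₂ * b * c * (γ₁ + γ₂) / K) * a * g ^ 2 -
      (1 + a * (γ₂ * c / (b * K) + γ₁ * b / (c * K))) * (τ ^ 2 * a ^ 2 - γ₁ * γ₂ * b * c) * g -
      (τ * a + 2 * γ₁ * γ₂ * b * c / K) ^ 2 = 0) :
    ∃ (x x' : Fin n → ℝ) (T : Matrix (Fin n) (Fin n) ℝ), T.PosDef ∧
      PSD.SpectrallyEquivalent A T γ₁ γ₂ ∧ x ≠ 0 ∧ x ∈ Submodule.span ℝ {u, v, w} ∧
      x' ∈ Submodule.span ℝ {u, v, w} ∧ PSD.mu A B x = s ∧ PSD.IsMuIterate A B T x x' ∧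
      PSD.mu A B x' = s + a * g := by
  have h2 : 0 < γ₂ := h1.trans_le h12
  have ha0 : 0 < a := by linarith [hs.2]
  have hb0 : 0 < b := by linarith [hs.1]
  have hbc : b ≤ c := by linarith
  have hc0 : 0 < c := by linarith
  have hK0 : 0 < K := by rw [hK]; positivity
  have hτ1 : γ₁ ≤ τ := by
    rw [hτ, le_div_iff₀ hK0, hK]
    have := mul_le_mul_of_nonneg_left h12 (mul_nonneg h1.le hb0.le)
    linarith
  have hτ2 : τ ≤ γ₂ := by
    rw [hτ, div_le_iff₀ hK0, hK]
    have := mul_le_mul_of_nonneg_left h12 (mul_nonneg h2.le hc0.le)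
    linarith
  have hτ0 : 0 < τ := h1.trans_le hτ1
  obtain ⟨T, hT, hTe, hTu, hTw, hTv⟩ := exists_preconditioner hA h1 hτ1 hτ2 huu hww huw
  have hsymm := dotProduct_mulVec_symm hA.isHermitian
  have hTv := hTv v huv (by rw [hsymm, hvw])
  -- x has coordinates (1, α, β). The shares b α² / a = γ₂ c / K and c β² / a = γ₁ b / K sum to 1,
  -- which gives μ(x) = s; they are the extremal Kantorovich weights for the values γ₁ b and γ₂ c.
  obtain ⟨α, hα⟩ : ∃ α : ℝ, α ^ 2 = γ₂ * c * a / (b * K) :=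
    ⟨√(γ₂ * c * a / (b * K)), Real.sq_sqrt (by positivity)⟩
  obtain ⟨β, hβ⟩ : ∃ β : ℝ, β ^ 2 = γ₁ * b * a / (c * K) :=
    ⟨√(γ₁ * b * a / (c * K)), Real.sq_sqrt (by positivity)⟩
  have hA3 : ∀ x₁ x₂ x₃ y₁ y₂ y₃ : ℝ, (x₁ • u + x₂ • v + x₃ • w) ⬝ᵥ
      (A *ᵥ (y₁ • u + y₂ • v + y₃ • w)) = x₁ * y₁ + x₂ * y₂ + x₃ * y₃ := by
    intro x₁ x₂ x₃ y₁ y₂ y₃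
    simp only [Matrix.mulVec_add, Matrix.mulVec_smul, dotProduct_add, add_dotProduct,
      smul_dotProduct, dotProduct_smul, smul_eq_mul, huu, hvv, hww, huv, huw, hvw,
      hsymm v u, hsymm w u, hsymm w v]
    ring
  have hB3 : ∀ y₁ y₂ y₃ : ℝ, B *ᵥ (y₁ • u + y₂ • v + y₃ • w) =
      A *ᵥ ((p * y₁) • u + (q * y₂) • v + (r * y₃) • w) := by
    intro y₁ y₂ y₃
    simp only [Matrix.mulVec_add, Matrix.mulVec_smul, hu, hv, hw, smul_smul, mul_comm]
  have hT3 : ∀ y₁ y₂ y₃ : ℝ, T *ᵥ (A *ᵥ (y₁ • u + y₂ • v + y₃ • w)) =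
      (τ * y₁) • u + (γ₁ * y₂) • v + (γ₂ * y₃) • w := by
    intro y₁ y₂ y₃
    simp only [Matrix.mulVec_add, Matrix.mulVec_smul, hTu, hTv, hTw, smul_smul, mul_comm]
  have hmem : ∀ y₁ y₂ y₃ : ℝ, y₁ • u + y₂ • v + y₃ • w ∈ Submodule.span ℝ {u, v, w} := by
    intro y₁ y₂ y₃
    refine add_mem (add_mem ?_ ?_) ?_ <;> refine Submodule.smul_mem _ _ (Submodule.subset_span ?_)
      <;> simp
  have hbal : b * α ^ 2 + c * β ^ 2 = a := by
    rw [hα, hβ]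
    field_simp
    rw [hK]; ring
  have hxx : ((1 : ℝ) • u + α • v + β • w) ⬝ᵥ (A *ᵥ ((1 : ℝ) • u + α • v + β • w)) =
      1 + a * (γ₂ * c / (b * K) + γ₁ * b / (c * K)) := by
    rw [hA3]
    linear_combination hα + hβ
  have hx : (1 : ℝ) • u + α • v + β • w ≠ 0 := by
    intro h0
    rw [h0, zero_dotProduct] at hxx
    have : 0 < 1 + a * (γ₂ * c / (b * K) + γ₁ * b / (c * K)) := by positivity
    linarith
  have hmu : PSD.mu A B ((1 : ℝ) • u + α • v + β • w) = s := by
    rw [PSD.mu, div_eq_iff (dotProduct_mulVec_pos' hA hx).ne', hB3, hA3, hA3]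
    have e1 : p = a + s := by linarith
    have e2 : q = s - b := by linarith
    have e3 : r = s - c := by linarith
    rw [e1, e2, e3]
    linear_combination -hbal
  have hdir : PSD.muDirection A B T ((1 : ℝ) • u + α • v + β • w) =
      (τ * a) • u + (γ₁ * (-b * α)) • v + (γ₂ * (-c * β)) • w := by
    rw [PSD.muDirection, hmu, hB3, ← Matrix.mulVec_smul, ← Matrix.mulVec_sub, ← hT3]
    congr 2
    rw [ha, hb, hc]
    module
  -- This is A-orthogonality of x and the search direction; it is what dictates τ.
  have hsplit : γ₁ * b * α ^ 2 + γ₂ * c * β ^ 2 = τ * a := by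
    rw [hα, hβ, hτ]
    field_simp
    ring
  have hsplit1 : b ^ 2 * α ^ 2 = γ₂ * b * c / K * a := by
    rw [hα]; field_simp
  have hsplit2 : c ^ 2 * β ^ 2 = γ₁ * b * c / K * a := by
    rw [hβ]; field_simp
  have hKi : γ₁ * b / K + γ₂ * c / K = 1 := by
    rw [← add_div, ← hK, div_self hK0.ne']
  obtain ⟨k, hk, hval⟩ := exists_isMuIterate (t := a * g)
    (Nx := 1 + a * (γ₂ * c / (b * K) + γ₁ * b / (c * K)))
    (Nd := a * (τ ^ 2 * a + γ₁ * γ₂ * b * c * (γ₁ + γ₂) / K))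
    (R := a * (τ * a + 2 * γ₁ * γ₂ * b * c / K))
    (Y := a * (τ ^ 2 * a ^ 2 - γ₁ * γ₂ * b * c)) hA hB hT hx hdir hmu hxx
    (by rw [hA3]; linear_combination -hsplit)
    (by
      rw [hA3]
      linear_combination γ₁ ^ 2 * hsplit1 + γ₂ ^ 2 * hsplit2)
    (by
      rw [hB3, hA3]
      have e1 : p = a + s := by linarith
      have e2 : q = s - b := by linarith
      have e3 : r = s - c := by linarith
      rw [e1, e2, e3]
      linear_combination γ₁ * hsplit1 + γ₂ * hsplit2 - s * hsplit)
    (by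
      rw [hB3, hA3]
      have e1 : p = a + s := by linarith
      have e2 : q = s - b := by linarith
      have e3 : r = s - c := by linarith
      rw [e1, e2, e3]
      linear_combination γ₁ ^ 2 * (s - b) * hsplit1 + γ₂ ^ 2 * (s - c) * hsplit2 -
        γ₁ * γ₂ * b * c * a * hKi)
    (by positivity) (by positivity)
    (by linear_combination a ^ 2 * hroot)
  refine ⟨_, _, T, hT, hTe, hx, hmem _ _ _, ?_, hmu, hk, hval⟩
  exact add_mem (hmem _ _ _) (Submodule.smul_mem _ _ (hmem _ _ _))

/-- The relative gain of the Ritz value in the extremal configuration. -/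
theorem exists_extremal_gain {γ₁ γ₂ p q r : ℝ} (h1 : 0 < γ₁) (h2 : 0 < γ₂) (hrq : r ≤ q)
    (hqp : q < p) :
    ∃ g : ℝ → ℝ, ContinuousAt g p ∧
      g p = 4 * γ₁ * γ₂ * (p - q) * (p - r) / (γ₁ * (p - q) + γ₂ * (p - r)) ^ 2 ∧
      ∀ s ∈ Set.Ioo q p, ∀ a b c K τ : ℝ, a = p - s → b = s - q → c = s - r →
        K = γ₁ * b + γ₂ * c → τ = γ₁ * γ₂ * (b + c) / K → 0 < g s ∧
        (1 + a * (γ₂ * c / (b * K) + γ₁ * b / (c * K))) *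
          (τ ^ 2 * a + γ₁ * γ₂ * b * c * (γ₁ + γ₂) / K) * a * g s ^ 2 -
        (1 + a * (γ₂ * c / (b * K) + γ₁ * b / (c * K))) *
          (τ ^ 2 * a ^ 2 - γ₁ * γ₂ * b * c) * g s -
        (τ * a + 2 * γ₁ * γ₂ * b * c / K) ^ 2 = 0 := by
  obtain ⟨a, ha⟩ : ∃ a : ℝ → ℝ, a = fun s => p - s := ⟨_, rfl⟩
  obtain ⟨b, hb⟩ : ∃ b : ℝ → ℝ, b = fun s => s - q := ⟨_, rfl⟩
  obtain ⟨c, hc⟩ : ∃ c : ℝ → ℝ, c = fun s => s - r := ⟨_, rfl⟩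
  obtain ⟨K, hK⟩ : ∃ K : ℝ → ℝ, K = fun s => γ₁ * b s + γ₂ * c s := ⟨_, rfl⟩
  obtain ⟨τ, hτ⟩ : ∃ τ : ℝ → ℝ, τ = fun s => γ₁ * γ₂ * (b s + c s) / K s := ⟨_, rfl⟩
  obtain ⟨N, hN⟩ : ∃ N : ℝ → ℝ, N = fun s =>
    1 + a s * (γ₂ * c s / (b s * K s) + γ₁ * b s / (c s * K s)) := ⟨_, rfl⟩
  obtain ⟨D, hD⟩ : ∃ D : ℝ → ℝ, D = fun s =>
    τ s ^ 2 * a s + γ₁ * γ₂ * b s * c s * (γ₁ + γ₂) / K s := ⟨_, rfl⟩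
  obtain ⟨Y, hY⟩ : ∃ Y : ℝ → ℝ, Y = fun s =>
    τ s ^ 2 * a s ^ 2 - γ₁ * γ₂ * b s * c s := ⟨_, rfl⟩
  obtain ⟨R, hR⟩ : ∃ R : ℝ → ℝ, R = fun s => τ s * a s + 2 * γ₁ * γ₂ * b s * c s / K s :=
    ⟨_, rfl⟩
  -- S is the square root of the discriminant. The leading coefficient N D a vanishes at s = p, so
  -- the positive root is taken in the conjugate form 2 R² / (S - N Y), which stays continuous there
  -- because Y(p) < 0.
  obtain ⟨S, hS⟩ : ∃ S : ℝ → ℝ, S = fun s =>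
    √((N s * Y s) ^ 2 + 4 * N s * D s * a s * R s ^ 2) := ⟨_, rfl⟩
  have hb0 : 0 < b p := by rw [hb]; simpa using hqp
  have hc0 : 0 < c p := by rw [hc]; simpa using hrq.trans_lt hqp
  have hK0 : 0 < K p := by rw [hK]; positivity
  have hap : a p = 0 := by rw [ha]; simp
  have hNp : N p = 1 := by rw [hN]; simp [hap]
  have hYp : Y p = -(γ₁ * γ₂ * b p * c p) := by rw [hY]; simp [hap]
  have hYneg : 0 < γ₁ * γ₂ * b p * c p := by positivity
  have hRp : R p = 2 * γ₁ * γ₂ * b p * c p / K p := by rw [hR]; simp [hap]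
  have hSp : S p = γ₁ * γ₂ * b p * c p := by
    rw [hS]
    simp only [hap, hNp, hYp]
    rw [mul_zero, zero_mul, add_zero, one_mul, neg_sq, Real.sqrt_sq hYneg.le]
  have ca : ContinuousAt a p := by rw [ha]; fun_prop
  have cb : ContinuousAt b p := by rw [hb]; fun_prop
  have cc : ContinuousAt c p := by rw [hc]; fun_prop
  have cK : ContinuousAt K p := by rw [hK]; fun_prop
  have cτ : ContinuousAt τ p := by rw [hτ]; fun_prop (disch := exact hK0.ne')
  have cN : ContinuousAt N p := by
    rw [hN]; fun_prop (disch := positivity)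
  have cD : ContinuousAt D p := by rw [hD]; fun_prop (disch := exact hK0.ne')
  have cY : ContinuousAt Y p := by rw [hY]; fun_prop
  have cR : ContinuousAt R p := by rw [hR]; fun_prop (disch := exact hK0.ne')
  have cS : ContinuousAt S p := by rw [hS]; fun_prop
  have hden : S p - N p * Y p ≠ 0 := by
    rw [hSp, hNp, hYp]; linarith
  refine ⟨fun s => 2 * R s ^ 2 / (S s - N s * Y s), ?_, ?_, ?_⟩
  · fun_prop (disch := exact hden)
  · simp only [hSp, hNp, hYp, hRp]
    have e1 : K p = γ₁ * (p - q) + γ₂ * (p - r) := by rw [hK, hb, hc]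
    have e2 : b p = p - q := by rw [hb]
    have e3 : c p = p - r := by rw [hc]
    rw [← e1, ← e2, ← e3]
    field_simp
    ring
  · rintro s ⟨hs1, hs2⟩ a' b' c' K' τ' ha' hb' hc' hK' hτ'
    have ea : a' = a s := by rw [ha', ha]
    have eb : b' = b s := by rw [hb', hb]
    have ec : c' = c s := by rw [hc', hc]
    have eK : K' = K s := by rw [hK', eb, ec, hK]
    have eτ : τ' = τ s := by rw [hτ', eb, ec, eK, hτ]
    have hN' : 1 + a' * (γ₂ * c' / (b' * K') + γ₁ * b' / (c' * K')) = N s := by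
      rw [ea, eb, ec, eK, hN]
    have hD' : τ' ^ 2 * a' + γ₁ * γ₂ * b' * c' * (γ₁ + γ₂) / K' = D s := by
      rw [ea, eb, ec, eK, eτ, hD]
    have hY' : τ' ^ 2 * a' ^ 2 - γ₁ * γ₂ * b' * c' = Y s := by
      rw [ea, eb, ec, eτ, hY]
    have hR' : τ' * a' + 2 * γ₁ * γ₂ * b' * c' / K' = R s := by
      rw [ea, eb, ec, eK, eτ, hR]
    have pa : 0 < a' := by linarith
    have pb : 0 < b' := by linarith
    have pc : 0 < c' := by linarith
    have pK : 0 < K' := by rw [hK']; positivity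
    have pτ : 0 < τ' := by rw [hτ']; positivity
    have pN : 0 < N s := by rw [← hN']; positivity
    have pD : 0 < D s := by rw [← hD']; positivity
    have pR : 0 < R s := by rw [← hR']; positivity
    rw [hN', hD', hY', hR', ea]
    rw [ea] at pa
    have hSs : S s ^ 2 = (N s * Y s) ^ 2 + 4 * N s * D s * a s * R s ^ 2 := by
      rw [hS]
      exact Real.sq_sqrt (by positivity)
    have hgt : 0 < S s - N s * Y s := by
      have h3 : N s * Y s < S s := by
        refine lt_of_abs_lt (abs_lt_of_sq_lt_sq ?_ ?_)
        · rw [hSs]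
          have : 0 < 4 * N s * D s * a s * R s ^ 2 := by positivity
          linarith
        · rw [hS]; positivity
      linarith
    refine ⟨by positivity, ?_⟩
    obtain ⟨G, hG⟩ : ∃ G, G = 2 * R s ^ 2 / (S s - N s * Y s) := ⟨_, rfl⟩
    have hGm : G * (S s - N s * Y s) = 2 * R s ^ 2 := by rw [hG, div_mul_cancel₀ _ hgt.ne']
    beta_reduce
    rw [← hG]
    apply mul_right_cancel₀ (b := 4 * R s ^ 2) (by positivity)
    linear_combination (-G ^ 2) * hSs + (G * (S s + N s * Y s) + 2 * R s ^ 2) * hGm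

theorem exists_smul_normalized {n : ℕ} {A : Matrix (Fin n) (Fin n) ℝ} (hA : A.PosDef)
    {x : Fin n → ℝ} (hx : x ≠ 0) : ∃ c : ℝ, (c • x) ⬝ᵥ (A *ᵥ (c • x)) = 1 := by
  have h := dotProduct_mulVec_pos' hA hx
  refine ⟨(√(x ⬝ᵥ (A *ᵥ x)))⁻¹, ?_⟩
  rw [Matrix.mulVec_smul, dotProduct_smul, smul_dotProduct, smul_eq_mul, smul_eq_mul, ← mul_assoc,
    ← mul_inv, Real.mul_self_sqrt h.le, inv_mul_cancel₀ h.ne']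

theorem eigenvector_dotProduct {n : ℕ} {A B : Matrix (Fin n) (Fin n) ℝ} (hA : A.PosDef)
    (hB : B.PosDef) {p q : ℝ} {u v : Fin n → ℝ} (hu : B *ᵥ u = p • (A *ᵥ u))
    (hv : B *ᵥ v = q • (A *ᵥ v)) : p = q ∨ u ⬝ᵥ (A *ᵥ v) = 0 := by
  have h1 := dotProduct_mulVec_symm hB.isHermitian u v
  rw [hu, hv, dotProduct_smul, dotProduct_smul, dotProduct_mulVec_symm hA.isHermitian v u,
    smul_eq_mul, smul_eq_mul] at h1
  rcases eq_or_ne p q with h | h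
  · exact Or.inl h
  · right
    have h2 : (p - q) * (u ⬝ᵥ (A *ᵥ v)) = 0 := by linarith
    exact (mul_eq_zero.mp h2).resolve_left (sub_ne_zero.mpr h)

/-- Three independent eigenvectors can be replaced by `A`-orthonormal ones in their span. -/
theorem exists_orthonormal_eigenvectors {n : ℕ} {A B : Matrix (Fin n) (Fin n) ℝ} (hA : A.PosDef)
    (hB : B.PosDef) {p q r : ℝ} (hrq : r ≤ q) (hqp : q < p) {u v w : Fin n → ℝ}
    (hli : LinearIndependent ℝ ![u, v, w]) (hu : B *ᵥ u = p • (A *ᵥ u))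
    (hv : B *ᵥ v = q • (A *ᵥ v)) (hw : B *ᵥ w = r • (A *ᵥ w)) :
    ∃ u' v' w' : Fin n → ℝ, B *ᵥ u' = p • (A *ᵥ u') ∧ B *ᵥ v' = q • (A *ᵥ v') ∧
      B *ᵥ w' = r • (A *ᵥ w') ∧ u' ⬝ᵥ (A *ᵥ u') = 1 ∧ v' ⬝ᵥ (A *ᵥ v') = 1 ∧
      w' ⬝ᵥ (A *ᵥ w') = 1 ∧ u' ⬝ᵥ (A *ᵥ v') = 0 ∧ u' ⬝ᵥ (A *ᵥ w') = 0 ∧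
      v' ⬝ᵥ (A *ᵥ w') = 0 ∧
      Submodule.span ℝ {u', v', w'} ≤ Submodule.span ℝ {u, v, w} := by
  have hu0 : u ≠ 0 := hli.ne_zero 0
  have hv0 : v ≠ 0 := hli.ne_zero 1
  have hvv := dotProduct_mulVec_pos' hA hv0
  -- Only v and w can share an eigenvalue, so one Gram–Schmidt step suffices; w - k v remains an
  -- eigenvector because either q = r or k = 0.
  obtain ⟨k, hk⟩ : ∃ k, k = (v ⬝ᵥ (A *ᵥ w)) / (v ⬝ᵥ (A *ᵥ v)) := ⟨_, rfl⟩
  have hw0 : w - k • v ≠ 0 := by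
    intro h0
    have h := Fintype.linearIndependent_iff.mp hli ![0, -k, 1] (by
      simp only [Fin.sum_univ_three, Matrix.cons_val_zero, Matrix.cons_val_one, Matrix.cons_val]
      rw [← h0]
      module) 2
    simp at h
  have hwe : B *ᵥ (w - k • v) = r • (A *ᵥ (w - k • v)) := by
    rw [Matrix.mulVec_sub, Matrix.mulVec_sub, Matrix.mulVec_smul, Matrix.mulVec_smul, hv, hw]
    rcases eigenvector_dotProduct hA hB hv hw with h | h
    · rw [h]; module
    · rw [hk, h, zero_div]; module
  have hvw : v ⬝ᵥ (A *ᵥ (w - k • v)) = 0 := by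
    rw [Matrix.mulVec_sub, Matrix.mulVec_smul, dotProduct_sub, dotProduct_smul, smul_eq_mul, hk,
      div_mul_cancel₀ _ hvv.ne', sub_self]
  have huv := (eigenvector_dotProduct hA hB hu hv).resolve_left hqp.ne'
  have huw := (eigenvector_dotProduct hA hB hu hwe).resolve_left (hrq.trans_lt hqp).ne'
  obtain ⟨c₁, h₁⟩ := exists_smul_normalized hA hu0
  obtain ⟨c₂, h₂⟩ := exists_smul_normalized hA hv0
  obtain ⟨c₃, h₃⟩ := exists_smul_normalized hA hw0
  refine ⟨c₁ • u, c₂ • v, c₃ • (w - k • v), ?_, ?_, ?_, h₁, h₂, h₃, ?_, ?_, ?_, ?_⟩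
  · rw [Matrix.mulVec_smul, Matrix.mulVec_smul, hu, smul_comm]
  · rw [Matrix.mulVec_smul, Matrix.mulVec_smul, hv, smul_comm]
  · rw [Matrix.mulVec_smul, Matrix.mulVec_smul, hwe, smul_comm]
  · rw [Matrix.mulVec_smul, dotProduct_smul, smul_dotProduct, huv, smul_zero, smul_zero]
  · rw [Matrix.mulVec_smul, dotProduct_smul, smul_dotProduct, huw, smul_zero, smul_zero]
  · rw [Matrix.mulVec_smul, dotProduct_smul, smul_dotProduct, hvw, smul_zero, smul_zero]
  · have mu' : u ∈ Submodule.span ℝ {u, v, w} := Submodule.subset_span (by simp)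
    have mv : v ∈ Submodule.span ℝ {u, v, w} := Submodule.subset_span (by simp)
    have mw : w ∈ Submodule.span ℝ {u, v, w} := Submodule.subset_span (by simp)
    rw [Submodule.span_le]
    rintro x (rfl | rfl | rfl)
    · exact Submodule.smul_mem _ _ mu'
    · exact Submodule.smul_mem _ _ mv
    · exact Submodule.smul_mem _ _ (sub_mem mw (Submodule.smul_mem _ _ mv))

/-- Asymptotic sharpness of the estimate in terms of the inverse Rayleigh quotient. -/
theorem mu_estimate_sharp {n : ℕ} {A B : Matrix (Fin n) (Fin n) ℝ} (hA : A.PosDef)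
    (hB : B.PosDef) {γ₁ γ₂ p q r : ℝ} (h1 : 0 < γ₁) (h12 : γ₁ ≤ γ₂) (hrq : r ≤ q) (hqp : q < p)
    {u v w : Fin n → ℝ} (hli : LinearIndependent ℝ ![u, v, w]) (hu : B *ᵥ u = p • (A *ᵥ u))
    (hv : B *ᵥ v = q • (A *ᵥ v)) (hw : B *ᵥ w = r • (A *ᵥ w)) :
    ∃ (X X' : ℝ → Fin n → ℝ) (T : ℝ → Matrix (Fin n) (Fin n) ℝ),
      (∀ s ∈ Set.Ioo q p, (T s).PosDef ∧ PSD.SpectrallyEquivalent A (T s) γ₁ γ₂ ∧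
        X s ≠ 0 ∧ X s ∈ Submodule.span ℝ {u, v, w} ∧ X' s ∈ Submodule.span ℝ {u, v, w} ∧
        PSD.mu A B (X s) = s ∧ PSD.IsMuIterate A B (T s) (X s) (X' s)) ∧
      Tendsto (fun s => ((p - PSD.mu A B (X' s)) / (PSD.mu A B (X' s) - q)) /
          ((p - s) / (s - q)))
        (𝓝[<] p) (𝓝 (PSD.sigma (PSD.kappaMu p q r) (PSD.gam γ₁ γ₂) ^ 2)) := by
  have h2 : 0 < γ₂ := h1.trans_le h12
  obtain ⟨u', v', w', hu', hv', hw', huu, hvv, hww, huv, huw, hvw, hspan⟩ :=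
    exists_orthonormal_eigenvectors hA hB hrq hqp hli hu hv hw
  obtain ⟨g, hgc, hgp, hg⟩ := exists_extremal_gain h1 h2 hrq hqp
  have hex : ∀ s, s ∈ Set.Ioo q p → ∃ (x x' : Fin n → ℝ) (T : Matrix (Fin n) (Fin n) ℝ),
      T.PosDef ∧ PSD.SpectrallyEquivalent A T γ₁ γ₂ ∧ x ≠ 0 ∧
      x ∈ Submodule.span ℝ {u', v', w'} ∧ x' ∈ Submodule.span ℝ {u', v', w'} ∧
      PSD.mu A B x = s ∧ PSD.IsMuIterate A B T x x' ∧
      PSD.mu A B x' = s + (p - s) * g s := by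
    intro s hs
    obtain ⟨hg0, hroot⟩ := hg s hs _ _ _ _ _ rfl rfl rfl rfl rfl
    exact exists_extremal_step hA hB h1 h12 hrq hs rfl rfl rfl rfl rfl hu' hv' hw' huu hvv hww
      huv huw hvw hg0 hroot
  choose! X X' T hT hTe hX hXm hXm' hmu hit hval using hex
  refine ⟨X, X', T, fun s hs => ⟨hT s hs, hTe s hs, hX s hs, hspan (hXm s hs),
    hspan (hXm' s hs), hmu s hs, hit s hs⟩, ?_⟩
  -- The right side is 1 - g(p), and 1 - 4 k k' / (k + k')² = ((k' - k) / (k' + k))² with k = γ₁ (p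
  -- - q), k' = γ₂ (p - r).
  have hσ : PSD.sigma (PSD.kappaMu p q r) (PSD.gam γ₁ γ₂) ^ 2 =
      (1 - g p) * (p - q) / ((p - q) + (p - p) * g p) := by
    have hb : 0 < p - q := by linarith
    have hc : 0 < p - r := by linarith
    have hK : 0 < γ₁ * (p - q) + γ₂ * (p - r) := by positivity
    have hS : PSD.sigma (PSD.kappaMu p q r) (PSD.gam γ₁ γ₂) =
        (γ₂ * (p - r) - γ₁ * (p - q)) / (γ₁ * (p - q) + γ₂ * (p - r)) := by
      have hs : 0 < γ₁ + γ₂ := by positivity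
      have hden : (2 - (q - r) / (p - r)) + (γ₂ - γ₁) / (γ₁ + γ₂) * ((q - r) / (p - r)) =
          2 * (γ₁ * (p - q) + γ₂ * (p - r)) / ((γ₁ + γ₂) * (p - r)) := by
        field_simp
        ring
      unfold PSD.sigma PSD.kappaMu PSD.gam
      rw [hden, div_eq_div_iff (by positivity) hK.ne']
      field_simp
      ring
    rw [hS, hgp, sub_self, zero_mul, add_zero, mul_div_cancel_right₀ _ hb.ne']
    field_simp
    ring
  have hcont : ContinuousAt (fun s => (1 - g s) * (s - q) / ((s - q) + (p - s) * g s)) p := by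
    have hne : (p - q) + (p - p) * g p ≠ 0 := by
      rw [sub_self, zero_mul, add_zero]
      linarith
    fun_prop (disch := exact hne)
  rw [hσ]
  refine (hcont.tendsto.mono_left nhdsWithin_le_nhds).congr' ?_
  filter_upwards [Ioo_mem_nhdsLT hqp] with s hs
  obtain ⟨hg0, -⟩ := hg s hs _ _ _ _ _ rfl rfl rfl rfl rfl
  have e1 : 0 < p - s := by linarith [hs.2]
  have e2 : 0 < s - q := by linarith [hs.1]
  have e3 : 0 < s - q + (p - s) * g s := by positivity
  rw [hval s hs]
  have e4 : p - (s + (p - s) * g s) = (p - s) * (1 - g s) := by ring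
  have e5 : s + (p - s) * g s - q = s - q + (p - s) * g s := by ring
  rw [e4, e5]
  field_simp

/-! ### Translation between the two Rayleigh quotients and the main theorem. -/

theorem rho_eq_one_div_mu {n : ℕ} (A B : Matrix (Fin n) (Fin n) ℝ) (x : Fin n → ℝ) :
    PSD.rho A B x = 1 / PSD.mu A B x := (one_div_div _ _).symm

/-- Since ρ(x) = 1 / μ(x), the two residuals are proportional with factor -μ(x), so the two lines
correspond with the same parameter. -/
theorem mu_line_eq {n : ℕ} {A B : Matrix (Fin n) (Fin n) ℝ} (T : Matrix (Fin n) (Fin n) ℝ)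
    (hA : A.PosDef) (hB : B.PosDef) {x : Fin n → ℝ} (hx : x ≠ 0) (t : ℝ) :
    PSD.mu A B x • x + t • PSD.muDirection A B T x =
      PSD.mu A B x • (x - t • PSD.direction A B T x) := by
  have hm := (mu_pos hA hB hx).ne'
  have h : PSD.muDirection A B T x = -(PSD.mu A B x) • PSD.direction A B T x := by
    rw [PSD.muDirection, PSD.direction, ← Matrix.mulVec_smul T, rho_eq_one_div_mu, smul_sub,
      smul_smul, neg_mul, mul_one_div_cancel hm]
    congr 1
    module
  rw [h]
  module

theorem direction_line_ne_zero {n : ℕ} {A B T : Matrix (Fin n) (Fin n) ℝ} (hA : A.PosDef)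
    (hB : B.PosDef) (hT : T.PosDef) {x : Fin n → ℝ} (hx : x ≠ 0) (t : ℝ) :
    x - t • PSD.direction A B T x ≠ 0 := by
  intro h
  have h1 := mu_line_eq T hA hB hx t
  have hm := (mu_pos hA hB hx).ne'
  refine muDirection_line_ne_zero (B := B) hA hT hx (t / PSD.mu A B x) ?_
  apply smul_right_injective _ hm
  simp only [smul_add, smul_smul, mul_div_cancel₀ _ hm]
  rw [h1, h, smul_zero]

theorem mu_line_le_iff {n : ℕ} {A B T : Matrix (Fin n) (Fin n) ℝ} (hA : A.PosDef)
    (hB : B.PosDef) (hT : T.PosDef) {x : Fin n → ℝ} (hx : x ≠ 0) (s t : ℝ) :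
    PSD.mu A B (PSD.mu A B x • x + t • PSD.muDirection A B T x) ≤
        PSD.mu A B (PSD.mu A B x • x + s • PSD.muDirection A B T x) ↔
      PSD.rho A B (x - s • PSD.direction A B T x) ≤
        PSD.rho A B (x - t • PSD.direction A B T x) := by
  have hm := (mu_pos hA hB hx).ne'
  rw [mu_line_eq T hA hB hx, mu_line_eq T hA hB hx, mu_smul A B hm, mu_smul A B hm,
    rho_eq_one_div_mu, rho_eq_one_div_mu,
    one_div_le_one_div (mu_pos hA hB (direction_line_ne_zero hA hB hT hx s))
      (mu_pos hA hB (direction_line_ne_zero hA hB hT hx t))]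

/-- The iterations in terms of the Rayleigh quotient and of its inverse coincide. -/
theorem isMuIterate_iff {n : ℕ} {A B T : Matrix (Fin n) (Fin n) ℝ} (hA : A.PosDef)
    (hB : B.PosDef) (hT : T.PosDef) {x x' : Fin n → ℝ} (hx : x ≠ 0) :
    PSD.IsMuIterate A B T x x' ↔ PSD.IsIterate A B T x x' := by
  have hm := (mu_pos hA hB hx).ne'
  unfold PSD.IsMuIterate PSD.IsIterate
  simp only [mu_line_le_iff hA hB hT hx]
  simp only [mu_line_eq T hA hB hx, (smul_right_injective _ hm).eq_iff]

theorem isMuUnboundedStepIterate_of {n : ℕ} {A B T : Matrix (Fin n) (Fin n) ℝ} (hA : A.PosDef)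
    (hB : B.PosDef) (hT : T.PosDef) {x x' : Fin n → ℝ} (hx : x ≠ 0)
    (h : PSD.IsUnboundedStepIterate A B T x x') : PSD.IsMuUnboundedStepIterate A B T x x' := by
  have hm := (mu_pos hA hB hx).ne'
  obtain ⟨hno, c, hc, hx'⟩ := h
  refine ⟨fun θ => ?_, -c / PSD.mu A B x, div_ne_zero (neg_ne_zero.mpr hc) hm, ?_⟩
  · obtain ⟨t, ht⟩ := hno θ
    refine ⟨t, ?_⟩
    rw [← not_le] at ht ⊢
    rwa [mu_line_le_iff hA hB hT hx]
  · have h1 := mu_line_eq T hA hB hx 1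
    rw [one_smul, one_smul, smul_sub, sub_eq_add_neg, add_right_inj] at h1
    rw [h1, hx', ← smul_neg, smul_smul, div_mul_cancel₀ _ hm, neg_smul, smul_neg, neg_neg]

/-- Passing to reciprocals changes the error ratio only by the constant l / l', which appears on
both sides of the estimate and cancels in the sharpness quotient. -/
theorem reciprocal_ratio {l l' t : ℝ} (hl : l ≠ 0) (hl' : l' ≠ 0) (ht : t ≠ 0) :
    (1 / t - l) / (l' - 1 / t) = l / l' * ((1 / l - t) / (t - 1 / l')) := by
  have e1 : 1 / t - l = l / t * (1 / l - t) := by field_simp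
  have e2 : l' - 1 / t = l' / t * (t - 1 / l') := by field_simp
  rw [e1, e2, mul_div_mul_comm, div_div_div_cancel_right₀ ht]

theorem kappaMu_one_div {l l' L : ℝ} (hl : l ≠ 0) (hl' : l' ≠ 0) (hL : L ≠ 0) :
    PSD.kappaMu (1 / l) (1 / l') (1 / L) = PSD.kappa l l' L := by
  have e1 : 1 / l' - 1 / L = (L - l') / (l' * L) := by field_simp
  have e2 : 1 / l - 1 / L = (L - l) / (l * L) := by field_simp
  unfold PSD.kappaMu PSD.kappa
  rw [e1, e2, div_div_div_eq]
  rw [show (L - l') * (l * L) = l * (L - l') * L by ring,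
    show l' * L * (L - l) = l' * (L - l) * L by ring, mul_div_mul_right _ _ hL]

/-- Indices are zero-based: `lam ⟨i, _⟩`, `lam ⟨i + 1, _⟩`, `lam ⟨n - 1, _⟩` are the eigenvalues
called `λ_{i+1}`, `λ_{i+2}`, `λ_n` in one-based numbering. -/
theorem theorem1p2 {n : ℕ} (A B : Matrix (Fin n) (Fin n) ℝ) (hA : A.PosDef) (hB : B.PosDef)
    (lam : Fin n → ℝ) (hlam : PSD.IsEigenvalueEnumeration A B lam)
    (i : ℕ) (hi : i + 1 < n) (li li1 ln : ℝ)
    (hli : li = lam ⟨i, by omega⟩) (hli1 : li1 = lam ⟨i + 1, hi⟩)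
    (hln : ln = lam ⟨n - 1, by omega⟩) :
    -- the convergence estimate
    (∀ (T : Matrix (Fin n) (Fin n) ℝ) (γ₁ γ₂ : ℝ), T.PosDef →
      PSD.SpectrallyEquivalent A T γ₁ γ₂ →
      ∀ x x' : Fin n → ℝ, x ≠ 0 →
        (PSD.IsIterate A B T x x' ∨ PSD.IsUnboundedStepIterate A B T x x') →
        li ≤ PSD.rho A B x → PSD.rho A B x < li1 →
        x' ≠ 0 ∧ PSD.rho A B x' ≤ PSD.rho A B x ∧
        (PSD.rho A B x' ≤ li ∨
          (PSD.rho A B x' - li) / (li1 - PSD.rho A B x') ≤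
            PSD.sigma (PSD.kappa li li1 ln) (PSD.gam γ₁ γ₂) ^ 2 *
              ((PSD.rho A B x - li) / (li1 - PSD.rho A B x)))) ∧
    -- the value of `γ` for a scaled preconditioner
    (∀ γ : ℝ, PSD.gam (1 - γ) (1 + γ) = γ) ∧
    -- sharpness, as `s = ρ(x)` decreases to `λ_i`
    (i + 2 < n → li < li1 → ∀ γ₁ γ₂ : ℝ, 0 < γ₁ → γ₁ ≤ γ₂ →
      ∀ u v w : Fin n → ℝ, LinearIndependent ℝ ![u, v, w] →
        A *ᵥ u = li • (B *ᵥ u) → A *ᵥ v = li1 • (B *ᵥ v) → A *ᵥ w = ln • (B *ᵥ w) →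
        ∃ (X X' : ℝ → Fin n → ℝ) (T : ℝ → Matrix (Fin n) (Fin n) ℝ),
          (∀ s ∈ Set.Ioo li li1,
            (T s).PosDef ∧ PSD.SpectrallyEquivalent A (T s) γ₁ γ₂ ∧
            X s ≠ 0 ∧ X s ∈ Submodule.span ℝ {u, v, w} ∧ X' s ∈ Submodule.span ℝ {u, v, w} ∧
            PSD.rho A B (X s) = s ∧ PSD.IsIterate A B (T s) (X s) (X' s)) ∧
          Tendsto (fun s => ((PSD.rho A B (X' s) - li) / (li1 - PSD.rho A B (X' s))) /
              ((s - li) / (li1 - s)))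
            (𝓝[>] li) (𝓝 (PSD.sigma (PSD.kappa li li1 ln) (PSD.gam γ₁ γ₂) ^ 2))) ∧
    -- the convergence estimate in terms of the reciprocals `μ = 1 / λ`
    (∀ (T : Matrix (Fin n) (Fin n) ℝ) (γ₁ γ₂ : ℝ), T.PosDef →
      PSD.SpectrallyEquivalent A T γ₁ γ₂ →
      ∀ x x' : Fin n → ℝ, x ≠ 0 →
        (PSD.IsMuIterate A B T x x' ∨ PSD.IsMuUnboundedStepIterate A B T x x') →
        1 / li1 < PSD.mu A B x → PSD.mu A B x ≤ 1 / li →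
        x' ≠ 0 ∧ PSD.mu A B x ≤ PSD.mu A B x' ∧
        (1 / li ≤ PSD.mu A B x' ∨
          (1 / li - PSD.mu A B x') / (PSD.mu A B x' - 1 / li1) ≤
            PSD.sigma (PSD.kappaMu (1 / li) (1 / li1) (1 / ln)) (PSD.gam γ₁ γ₂) ^ 2 *
              ((1 / li - PSD.mu A B x) / (PSD.mu A B x - 1 / li1)))) ∧
    -- sharpness in terms of the reciprocals, as `s = μ(x)` increases to `μ_i`
    (i + 2 < n → li < li1 → ∀ γ₁ γ₂ : ℝ, 0 < γ₁ → γ₁ ≤ γ₂ →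
      ∀ u v w : Fin n → ℝ, LinearIndependent ℝ ![u, v, w] →
        B *ᵥ u = (1 / li) • (A *ᵥ u) → B *ᵥ v = (1 / li1) • (A *ᵥ v) →
        B *ᵥ w = (1 / ln) • (A *ᵥ w) →
        ∃ (X X' : ℝ → Fin n → ℝ) (T : ℝ → Matrix (Fin n) (Fin n) ℝ),
          (∀ s ∈ Set.Ioo (1 / li1) (1 / li),
            (T s).PosDef ∧ PSD.SpectrallyEquivalent A (T s) γ₁ γ₂ ∧
            X s ≠ 0 ∧ X s ∈ Submodule.span ℝ {u, v, w} ∧ X' s ∈ Submodule.span ℝ {u, v, w} ∧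
            PSD.mu A B (X s) = s ∧ PSD.IsMuIterate A B (T s) (X s) (X' s)) ∧
          Tendsto (fun s => ((1 / li - PSD.mu A B (X' s)) / (PSD.mu A B (X' s) - 1 / li1)) /
              ((1 / li - s) / (s - 1 / li1)))
            (𝓝[<] (1 / li))
            (𝓝 (PSD.sigma (PSD.kappaMu (1 / li) (1 / li1) (1 / ln)) (PSD.gam γ₁ γ₂) ^ 2))) := by
  have hpos := eigenvalue_pos hA hB hlam
  have hl0 : 0 < li := hli ▸ hpos _
  have hl1 : 0 < li1 := hli1 ▸ hpos _
  have hL : 0 < ln := hln ▸ hpos _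
  have hle : li ≤ li1 := by
    rw [hli, hli1]
    exact hlam.1 (Fin.mk_le_mk.mpr (Nat.le_succ i))
  have hle' : li1 ≤ ln := by
    rw [hli1, hln]
    exact hlam.1 (Fin.mk_le_mk.mpr (by omega))
  have hrq : 1 / ln ≤ 1 / li1 := one_div_le_one_div_of_le hl1 hle'
  have hspec : ∀ (v : Fin n → ℝ) (ρ : ℝ), v ≠ 0 → B *ᵥ v = ρ • (A *ᵥ v) →
      1 / li ≤ ρ ∨ (1 / ln ≤ ρ ∧ ρ ≤ 1 / li1) := by
    intro v ρ hv hev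
    have hρ : 0 < ρ := by
      have h1 := dotProduct_mulVec_pos' hB hv
      rw [hev, dotProduct_smul, smul_eq_mul] at h1
      exact pos_of_mul_pos_left h1 (dotProduct_mulVec_pos' hA hv).le
    obtain ⟨j, hj⟩ := exists_eq_of_eigenvector hB hlam hv (ρ := 1 / ρ)
      (by rw [hev, smul_smul, one_div_mul_cancel hρ.ne', one_smul])
    have hj' : ρ = 1 / lam j := by rw [← hj, one_div_one_div]
    rw [hj']
    rcases Nat.lt_or_ge i j.1 with h | h
    · right
      constructor
      · rw [hln]
        exact one_div_le_one_div_of_le (hpos j) (hlam.1 (Fin.le_def.mpr (by simp; omega)))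
      · rw [hli1]
        exact one_div_le_one_div_of_le (hpos _) (hlam.1 (Fin.le_def.mpr (by simpa using h)))
    · left
      rw [hli]
      exact one_div_le_one_div_of_le (hpos j) (hlam.1 (Fin.le_def.mpr (by simpa using h)))
  have hn : 0 < n := by omega
  have hflip : ∀ {l : ℝ} {u : Fin n → ℝ}, 0 < l → A *ᵥ u = l • (B *ᵥ u) →
      B *ᵥ u = (1 / l) • (A *ᵥ u) := by
    intro l u hl hu
    rw [hu, smul_smul, one_div_mul_cancel hl.ne', one_smul]
  refine ⟨?_, ?_, ?_, ?_, ?_⟩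
  · intro T γ₁ γ₂ hT hTe x x' hx hx' hlow hupp
    have hm := mu_pos hA hB hx
    rw [rho_eq_one_div_mu] at hlow hupp
    have hit : PSD.IsMuIterate A B T x x' ∨ PSD.IsMuUnboundedStepIterate A B T x x' :=
      hx'.imp (isMuIterate_iff hA hB hT hx).mpr (isMuUnboundedStepIterate_of hA hB hT hx)
    obtain ⟨hne, hmono, hest⟩ := mu_estimate hn hA hB hT hTe hrq hspec hx hit
      ((one_div_lt hl1 hm).mpr hupp) ((le_one_div hl0 hm).mp hlow)
    have hm' := mu_pos hA hB hne
    rw [rho_eq_one_div_mu, rho_eq_one_div_mu]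
    refine ⟨hne, one_div_le_one_div_of_le hm hmono, hest.imp (fun h => ?_) fun h => ?_⟩
    · exact (one_div_le hm' hl0).mpr h
    · rw [reciprocal_ratio hl0.ne' hl1.ne' hm'.ne', reciprocal_ratio hl0.ne' hl1.ne' hm.ne',
        ← kappaMu_one_div hl0.ne' hl1.ne' hL.ne', mul_left_comm]
      exact mul_le_mul_of_nonneg_left h (by positivity)
  · intro γ
    unfold PSD.gam
    ring
  · intro _ hlt γ₁ γ₂ h1 h12 u v w hli hu hv hw
    obtain ⟨X, X', T, hX, hlim⟩ := mu_estimate_sharp hA hB h1 h12 hrq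
      (one_div_lt_one_div_of_lt hl0 hlt) hli (hflip hl0 hu) (hflip hl1 hv) (hflip hL hw)
    have hmem : ∀ s ∈ Set.Ioo li li1, 1 / s ∈ Set.Ioo (1 / li1) (1 / li) := fun s hs =>
      ⟨one_div_lt_one_div_of_lt (hl0.trans hs.1) hs.2, one_div_lt_one_div_of_lt hl0 hs.1⟩
    refine ⟨fun s => X (1 / s), fun s => X' (1 / s), fun s => T (1 / s), fun s hs => ?_, ?_⟩
    · obtain ⟨g1, g2, g3, g4, g5, g6, g7⟩ := hX _ (hmem s hs)
      refine ⟨g1, g2, g3, g4, g5, ?_, (isMuIterate_iff hA hB g1 g3).mp g7⟩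
      rw [rho_eq_one_div_mu, g6, one_div_one_div]
    · rw [← kappaMu_one_div hl0.ne' hl1.ne' hL.ne']
      -- Inversion is decreasing, so approach to λ_i from above becomes approach to μ_i from below.
      have hinv : Tendsto (fun s : ℝ => 1 / s) (𝓝[>] li) (𝓝[<] (1 / li)) := by
        refine tendsto_nhdsWithin_of_tendsto_nhds_of_eventually_within _ ?_ ?_
        · have h : ContinuousAt (fun s : ℝ => 1 / s) li := by
            fun_prop (disch := exact hl0.ne')
          exact h.tendsto.mono_left nhdsWithin_le_nhds
        · filter_upwards [Ioo_mem_nhdsGT hlt] with s hs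
          exact (hmem s hs).2
      refine (hlim.comp hinv).congr' ?_
      filter_upwards [Ioo_mem_nhdsGT hlt] with s hs
      obtain ⟨g1, g2, g3, g4, g5, g6, g7⟩ := hX _ (hmem s hs)
      have hs0 : 0 < s := hl0.trans hs.1
      have hne := (mu_iterate_optimal hA hB g1 g3 (Or.inl g7)).1
      have hr := reciprocal_ratio hl0.ne' hl1.ne' (one_div_pos.mpr hs0).ne'
      rw [one_div_one_div] at hr
      rw [Function.comp_apply, rho_eq_one_div_mu,
        reciprocal_ratio hl0.ne' hl1.ne' (mu_pos hA hB hne).ne', hr,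
        mul_div_mul_left _ _ (div_ne_zero hl0.ne' hl1.ne')]
  · intro T γ₁ γ₂ hT hTe x x' hx hx' hlow hupp
    exact mu_estimate hn hA hB hT hTe hrq hspec hx hx' hlow hupp
  · intro _ hlt γ₁ γ₂ h1 h12 u v w hli hu hv hw
    exact mu_estimate_sharp hA hB h1 h12 hrq (one_div_lt_one_div_of_lt hl0 hlt) hli hu hv hw
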